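/- Let $\mathbb H$ be the upper half-plane and, for $\tau\in\mathbb H$, $z\in\mathbb C$, put $q=e^{2\pi i\tau}$, $\zeta=e^{2\pi i z}$. Let $\mathrm{Li}_3(w)=\sum_{n\ge1}w^n/n^3$ and let $B_n$ be the Bernoulli numbers, $\frac{x}{e^x-1}=\sum_{n\ge 0} B_n\frac{x^n}{n!}$. Put \[ \mathcal{L}i_3(\zeta,q)=\sum_{n\ge0}\mathrm{Li}_3(q^n\zeta)+\sum_{n\ge1}\mathrm{Li}_3(q^n\zeta^{-1})-\sum_{j=0}^{3}\frac{B_{j+1}}{(3-j)!\,(j+1)!}(2\pi i z)^{3-j}(2\pi i\tau)^j , \] and define the elliptic trilogarithm \[ f(z,\tau)=\frac1{(2\pi i)^3}\bigl\{\mathcal{L}i_3(\zeta,q)-\mathcal{L}i_3(1,q)\bigr\} \] by these series for $0<\operatorname{Im}z<\operatorname{Im}\tau$ (in $\mathcal{L}i_3(1,q)$ one takes $z=0$), and elsewhere by analytic continuation in $(z,\tau)$ along paths in $\Omega=\{(z,\tau)\in\mathbb C\times\mathbb H:\ z\notin\mathbb Z+\mathbb Z\tau\}$. Write $f^{(n,m)}=\partial^{n+m}f/\partial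 z^n\partial\tau^m$, and let $E_4(\tau)=1+240\sum_{n\ge1}\sigma_3(n)q^n$. Then $f$ has a (possibly multivalued) analytic continuation to a neighbourhood of every point of $\Omega$, and for all $\tau\in\mathbb H$ and $x,y\in\mathbb C$ such that none of $x$, $y$, $x+y$, $x+2y$ lies in $\mathbb Z+\mathbb Z\tau$ the following four identities (associated with the positive roots $\alpha,\beta,\alpha+\beta,\alpha+2\beta$ of $B_2$) hold, whatever branches of $f$ are used near the four points $x,y,x+y,x+2y$ (the argument $\tau$ of $f$ is suppressed). Set $B_2$(a): \[ \begin{aligned} &f^{(3,0)}(x)\bigl[f^{(2,1)}(y)-f^{(2,1)}(x+y)\bigr]+f^{(3,0)}(x+y)\bigl[f^{(2,1)}(x)-f^{(2,1)}(x+2y)\bigr]\\ &\quad+f^{(3,0)}(x+2y)\bigl[f^{(2,1)}(x+y)-f^{(2,1)}(y)\bigr]\\ &\quad+\tfrac12f^{(1,2)}(x)-\tfrac12f^{(1,2)}(x+2y)-2f^{(1,2)}(y)=0, \end{aligned} \] \[ \begin{aligned} &f^{(3,0)}(y)\bigl[f^{(2,1)}(x+2y)-f^{(2,1)}(x)\bigr]+f^{(3,0)}(x+y)\bigl[f^{(2,1)}(x)-f^{(2,1)}(x+2y)\bigr]\\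 &\quad+2f^{(3,0)}(x+2y)\bigl[f^{(2,1)}(x+y)-f^{(2,1)}(y)\bigr]\\ &\quad+f^{(1,2)}(x)+2f^{(1,2)}(x+y)-2f^{(1,2)}(y)=0. \end{aligned} \] Set $B_2$(b): \[ \begin{aligned} &f^{(3,0)}(x)\bigl[f^{(1,2)}(x+y)-f^{(1,2)}(y)\bigr]+f^{(3,0)}(x+y)\bigl[f^{(1,2)}(x)+f^{(1,2)}(x+2y)\bigr]\\ &\quad+f^{(3,0)}(x+2y)\bigl[f^{(1,2)}(x+y)+f^{(1,2)}(y)\bigr]-2f^{(2,1)}(x+y)\bigl[f^{(2,1)}(x)+f^{(2,1)}(x+2y)\bigr]\\ &\quad+\tfrac13\bigl\{f^{(0,3)}(x)+2f^{(0,3)}(x+y)+f^{(0,3)}(x+2y)+6f^{(0,3)}(y)\bigr\}+\tfrac1{36}E_4(\tau)=0, \end{aligned} \] \[ \begin{aligned} &f^{(3,0)}(y)\bigl[f^{(1,2)}(x+2y)-f^{(1,2)}(x)\bigr]+4f^{(3,0)}(x+2y)\bigl[f^{(1,2)}(y)+f^{(1,2)}(x+y)\bigr]\\ &\quad+f^{(3,0)}(x+y)\bigl[f^{(1,2)}(x)+f^{(1,2)}(x+2y)\bigr]-4f^{(2,1)}(x+2y)\bigl[f^{(2,1)}(x+y)+f^{(2,1)}(y)\bigr]\\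 &\quad+\tfrac13\bigl\{3f^{(0,3)}(x)+8f^{(0,3)}(x+y)+f^{(0,3)}(x+2y)+8f^{(0,3)}(y)\bigr\}+\tfrac1{18}E_4(\tau)=0. \end{aligned} \] -/

import Mathlib

open scoped UpperHalfPlane Topology

noncomputable section

namespace EllipticTrilog

/-- The classical polylogarithm series `Li_r(w) = ∑_{n ≥ 1} w ^ n / n ^ r`. -/
def polylog (r : ℕ) (w : ℂ) : ℂ :=
  ∑' n : ℕ, w ^ (n + 1) / ((n : ℂ) + 1) ^ r

/-- `χ_r(ζ, q) = ∑_{j=0}^{r} B_{j+1} / ((r-j)! (j+1)!) (log ζ)^(r-j) (log q)^j`,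
where `ζ = e^{2πiz}`, `q = e^{2πiτ}`, `log ζ = 2πiz`, `log q = 2πiτ`
(and `B_1 = -1/2`, as in `x / (e^x - 1) = ∑ B_n x^n / n!`). -/
def chi (r : ℕ) (z τ : ℂ) : ℂ :=
  ∑ j ∈ Finset.range (r + 1),
    (bernoulli (j + 1) : ℂ) / ((Nat.factorial (r - j) : ℂ) * (Nat.factorial (j + 1) : ℂ)) *
      (2 * Real.pi * Complex.I * z) ^ (r - j) * (2 * Real.pi * Complex.I * τ) ^ j

/-- The elliptic polylogarithm
`∑_{n ≥ 0} Li_r(q^n ζ) + ∑_{n ≥ 1} Li_r(q^n ζ⁻¹) - χ_r(ζ, q)` (`r` odd),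
with `ζ = e^{2πiz}` and `q = e^{2πiτ}`. -/
def ellipticPolylog (r : ℕ) (z τ : ℂ) : ℂ :=
  (∑' n : ℕ, polylog r (Complex.exp (2 * Real.pi * Complex.I * τ) ^ n *
      Complex.exp (2 * Real.pi * Complex.I * z))) +
    (∑' n : ℕ, polylog r (Complex.exp (2 * Real.pi * Complex.I * τ) ^ (n + 1) *
      (Complex.exp (2 * Real.pi * Complex.I * z))⁻¹)) -
    chi r z τ

/-- The elliptic trilogarithm `f(z, τ)`, at `p = (z, τ)`, by its defining series. The value is
used only for `0 < Im z < Im τ`, where all arguments of `Li_3` in the `z`-dependent sums have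
modulus less than one; elsewhere `f` is defined by analytic continuation (`IsBranchAt`). -/
def trilogSeries (p : ℂ × ℂ) : ℂ :=
  1 / (2 * Real.pi * Complex.I) ^ 3 * (ellipticPolylog 3 p.1 p.2 - ellipticPolylog 3 0 p.2)

/-- The strip `0 < Im z < Im τ`. -/
def strip : Set (ℂ × ℂ) := {p | 0 < p.1.im ∧ p.1.im < p.2.im}

/-- The pairs `(z, τ)` with `Im τ > 0` and `z ∉ ℤ + ℤ τ`. -/
def regularSet : Set (ℂ × ℂ) :=
  {p | 0 < p.2.im ∧ ∀ m n : ℤ, p.1 ≠ (m : ℂ) + (n : ℂ) * p.2}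

/-- `g` is, near `p`, a branch of the elliptic trilogarithm: it is obtained from the defining series
by analytic continuation along a path in `regularSet` that starts in the strip and ends at `p`.
`G t` is the function element carried at time `t`. -/
def IsBranchAt (g : ℂ × ℂ → ℂ) (p : ℂ × ℂ) : Prop :=
  ∃ (γ : unitInterval → ℂ × ℂ) (G : unitInterval → ℂ × ℂ → ℂ),
    Continuous γ ∧ (∀ t, γ t ∈ regularSet) ∧
    γ 0 ∈ strip ∧ G 0 =ᶠ[𝓝 (γ 0)] trilogSeries ∧
    (∀ t, ∀ᶠ w in 𝓝 (γ t), DifferentiableAt ℂ (G t) w) ∧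
    (∀ t, ∀ᶠ s in 𝓝 t, G s =ᶠ[𝓝 (γ s)] G t) ∧
    γ 1 = p ∧ g =ᶠ[𝓝 p] G 1

/-- The partial derivative `g^{(n,m)} = ∂^{n+m} g / ∂z^n ∂τ^m` at `(z, τ)`. -/
def pd (n m : ℕ) (g : ℂ × ℂ → ℂ) (z τ : ℂ) : ℂ :=
  iteratedDeriv n (fun z' => iteratedDeriv m (fun τ' => g (z', τ')) τ) z

end EllipticTrilog

end

/-! The function `f` is multivalued, but its third derivatives are not. Three derivatives turn
`Li_3` into the rational function `Li_0(w) = w / (1 - w)`, so the third partials are sums of `± k^m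
Li_0(e(±z + kτ))` with `m = 0, 1, 2, 3`, up to terms free of `z`; these are `fA`, `fB`, `fC`, `fD`.
Two functions with the same third jet differ locally by a polynomial of degree at most two in `(z,
τ)`. Hence the jet is carried along every continuation (`IsBranchAt.hasThirdJet`), and a local
threefold primitive, corrected by such a polynomial, continues any branch across a ball. For fixed
`τ` the plane minus the lattice is connected, so every regular point is reached
(`exists_isBranchAt`).

What remains is a set of identities between functions of `z` for fixed `τ`. Put `fE = fD + E_4 /
120`. Then `fA`, `fB`, `fC`, `fE` are 1-periodic, alternately odd and even, and `z ↦ z + τ` acts on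
them by a unipotent affine map with rational coefficients. Only `fA` is singular on the lattice,
with at most simple poles.

The `B_2` identities are linear combinations of the three-point relations `relT = 0` and `relU = 0`
for `x`, `y`, `x + y`, which in turn rest on `relV = 0`. These are proved in order of weight. In `x`
each expression is elliptic with removable singularities, hence constant by Liouville
(`exists_const_of_elliptic`). In `y` the shift by `τ` adds a combination of relations of lower
weight, already known to vanish (`relV` is symmetric), so the expression is constant there too. A
separately constant expression is constant, and its value is found by averaging over a horizontal
unit square on which `x`, `y`, `x + y` stay in the strip `0 < Im < Im τ`. There the means of `fA`,
`fB`, `fC`, `fE` are `1/2`, `-1/12`, `0`, `1/120`, the mean of each product is the product of the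
means, and the resulting rational number is `0` (`eq_zero_of_mean`). -/

noncomputable section

namespace EllipticTrilog

open Complex Filter Set

/-! ### The exponential, `Li_0`, and polylogarithms on the upper half-plane. -/

/-- `e(u) = exp(2πiu)`. -/
def ex (u : ℂ) : ℂ := cexp (2 * Real.pi * I * u)

lemma two_pi_I_ne : (2 * Real.pi * I : ℂ) ≠ 0 := two_pi_I_ne_zero

lemma norm_ex (u : ℂ) : ‖ex u‖ = Real.exp (-(2 * Real.pi * u.im)) := by
  rw [ex, Complex.norm_exp]; congr 1; simp

lemma ex_add (u v : ℂ) : ex (u + v) = ex u * ex v := by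
  simp only [ex, mul_add, Complex.exp_add]

lemma ex_neg (u : ℂ) : ex (-u) = (ex u)⁻¹ := by
  simp only [ex, mul_neg, Complex.exp_neg]

lemma ex_ne_zero (u : ℂ) : ex u ≠ 0 := Complex.exp_ne_zero _

lemma ex_int (n : ℤ) : ex n = 1 := by
  rw [ex, mul_comm]; exact Complex.exp_int_mul_two_pi_mul_I n

lemma ex_eq_one_iff (u : ℂ) : ex u = 1 ↔ ∃ n : ℤ, u = n := by
  rw [ex, Complex.exp_eq_one_iff]
  refine exists_congr fun n => ?_
  rw [mul_comm (n : ℂ)]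
  exact mul_right_inj' two_pi_I_ne

lemma ex_nat_mul (n : ℕ) (u : ℂ) : ex (n * u) = ex u ^ n := by
  rw [ex, ex, ← Complex.exp_nat_mul]; congr 1; ring

lemma hasDerivAt_ex (u : ℂ) : HasDerivAt ex (2 * Real.pi * I * ex u) u := by
  have := ((hasDerivAt_id u).const_mul (2 * Real.pi * I : ℂ)).cexp
  rw [mul_one] at this
  exact this.congr_deriv (mul_comm _ _)

lemma norm_ex_le {δ : ℝ} {u : ℂ} (h : δ ≤ u.im) : ‖ex u‖ ≤ Real.exp (-(2 * Real.pi * δ)) := by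
  rw [norm_ex]; gcongr

lemma exp_neg_lt_one {δ : ℝ} (h : 0 < δ) : Real.exp (-(2 * Real.pi * δ)) < 1 := by
  rw [Real.exp_lt_one_iff]; have := Real.pi_pos; have := mul_pos this h; linarith

lemma norm_ex_lt_one {u : ℂ} (h : 0 < u.im) : ‖ex u‖ < 1 :=
  (norm_ex_le le_rfl).trans_lt (exp_neg_lt_one h)

/-- `Li_0(e(u))`, as a meromorphic function on the whole plane. -/
def L0 (u : ℂ) : ℂ := ex u / (1 - ex u)

lemma L0_add_int (u : ℂ) (n : ℤ) : L0 (u + n) = L0 u := by simp [L0, ex_add, ex_int]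

/-- Inversion for `Li_0`. It makes `fA`, with its constant `1/2`, odd, and it enters all the laws
for translation by `τ`. -/
lemma L0_add_L0_neg {u : ℂ} (h : ∀ n : ℤ, u ≠ n) : L0 u + L0 (-u) = -1 := by
  have h1 : ex u ≠ 1 := fun h' => by
    obtain ⟨n, hn⟩ := (ex_eq_one_iff u).1 h'
    exact h n hn
  have h0 := ex_ne_zero u
  have h2 : 1 - ex u ≠ 0 := sub_ne_zero.2 (Ne.symm h1)
  have h3 : ex u - 1 ≠ 0 := sub_ne_zero.2 h1
  have h4 : 1 - (ex u)⁻¹ = (ex u - 1) / ex u := by field_simp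
  rw [L0, L0, ex_neg, h4]
  field_simp
  ring

/-- The derivative of `L0`. -/
def L0' (u : ℂ) : ℂ := 2 * Real.pi * I * ex u / (1 - ex u) ^ 2

lemma hasDerivAt_L0 {u : ℂ} (h : ∀ n : ℤ, u ≠ n) : HasDerivAt L0 (L0' u) u := by
  have h1 : 1 - ex u ≠ 0 := fun h' => by
    obtain ⟨n, hn⟩ := (ex_eq_one_iff u).1 (sub_eq_zero.1 h').symm
    exact h n hn
  have := (hasDerivAt_ex u).fun_div ((hasDerivAt_ex u).const_sub 1) h1
  refine this.congr_deriv ?_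
  rw [L0']; congr 1; ring

lemma ne_int_of_im_pos {u : ℂ} (h : 0 < u.im) (n : ℤ) : u ≠ n := by
  rintro rfl; simp at h

/-- Exponential decay towards `i∞`. -/
def ExpDecay (φ : ℂ → ℂ) : Prop :=
  ∀ δ : ℝ, 0 < δ → ∃ C : ℝ, 0 ≤ C ∧ ∀ u : ℂ, δ ≤ u.im → ‖φ u‖ ≤ C * ‖ex u‖

lemma one_sub_le_norm_one_sub_ex {δ : ℝ} {u : ℂ} (h : δ ≤ u.im) :
    1 - Real.exp (-(2 * Real.pi * δ)) ≤ ‖1 - ex u‖ := by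
  have := norm_sub_norm_le 1 (ex u)
  rw [norm_one] at this
  linarith [norm_ex_le h]

lemma expDecay_L0 : ExpDecay L0 := by
  intro δ hδ
  have h1 := exp_neg_lt_one hδ
  refine ⟨(1 - Real.exp (-(2 * Real.pi * δ)))⁻¹, by
    rw [inv_nonneg]; linarith, fun u hu => ?_⟩
  rw [L0, norm_div, div_eq_inv_mul]
  have := one_sub_le_norm_one_sub_ex hu
  gcongr

lemma expDecay_L0' : ExpDecay L0' := by
  intro δ hδ
  have h1 := exp_neg_lt_one hδ
  refine ⟨((1 - Real.exp (-(2 * Real.pi * δ))) ^ 2)⁻¹ * ‖(2 * Real.pi * I : ℂ)‖, by positivity,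
    fun u hu => ?_⟩
  have h2 := one_sub_le_norm_one_sub_ex hu
  have h3 : 0 < 1 - Real.exp (-(2 * Real.pi * δ)) := by linarith
  rw [L0', norm_div, norm_mul _ (ex u), norm_pow, div_eq_inv_mul, ← mul_assoc]
  refine mul_le_mul_of_nonneg_right (mul_le_mul_of_nonneg_right ?_ (norm_nonneg _))
    (norm_nonneg _)
  gcongr

/-- `(2πi)^{-r} Li_r(e(u))`. -/
def psi (r : ℕ) (u : ℂ) : ℂ := ((2 * Real.pi * I) ^ r)⁻¹ * polylog r (ex u)

lemma norm_polylog_term (r : ℕ) (w : ℂ) (n : ℕ) :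
    ‖w ^ (n + 1) / ((n : ℂ) + 1) ^ r‖ ≤ ‖w‖ ^ (n + 1) := by
  rw [norm_div, norm_pow, norm_pow]
  refine div_le_self (by positivity) (one_le_pow₀ ?_)
  have : ‖(n : ℂ) + 1‖ = (n : ℝ) + 1 := by
    rw [← Nat.cast_succ, Complex.norm_natCast, Nat.cast_succ]
  rw [this]; linarith [(n.cast_nonneg : (0 : ℝ) ≤ n)]

lemma hasSum_pow_succ {ρ : ℝ} (h0 : 0 ≤ ρ) (h1 : ρ < 1) :
    HasSum (fun n : ℕ => ρ ^ (n + 1)) (ρ / (1 - ρ)) := by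
  simpa [pow_succ', div_eq_mul_inv] using (hasSum_geometric_of_lt_one h0 h1).mul_left ρ

lemma psi_zero {u : ℂ} (h : 0 < u.im) : psi 0 u = L0 u := by
  have := (hasSum_geometric_of_norm_lt_one (norm_ex_lt_one h)).mul_left (ex u)
  simp only [psi, polylog, pow_zero, inv_one, one_mul, L0, pow_succ', div_eq_mul_inv]
  simpa only [mul_one] using this.tsum_eq

lemma norm_polylog_le (r : ℕ) {w : ℂ} (h : ‖w‖ < 1) : ‖polylog r w‖ ≤ ‖w‖ / (1 - ‖w‖) :=
  tsum_of_norm_bounded (hasSum_pow_succ (norm_nonneg w) h) (norm_polylog_term r w)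

lemma expDecay_psi (r : ℕ) : ExpDecay (psi r) := by
  intro δ hδ
  have h1 := exp_neg_lt_one hδ
  refine ⟨‖((2 * Real.pi * I : ℂ) ^ r)⁻¹‖ * (1 - Real.exp (-(2 * Real.pi * δ)))⁻¹, ?_,
    fun u hu => ?_⟩
  · have : 0 ≤ (1 - Real.exp (-(2 * Real.pi * δ)))⁻¹ := by rw [inv_nonneg]; linarith
    positivity
  have h2 := norm_ex_le hu
  rw [psi, norm_mul, mul_assoc ‖((2 * Real.pi * I : ℂ) ^ r)⁻¹‖]
  refine mul_le_mul_of_nonneg_left ?_ (norm_nonneg ((2 * Real.pi * I : ℂ) ^ r)⁻¹)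
  refine (norm_polylog_le r (h2.trans_lt h1)).trans ?_
  rw [div_eq_inv_mul]
  gcongr

/-- Termwise differentiation on the half-plane `Im v > Im u / 2`, with a geometric majorant. The
factor `(2πi)^{-r}` in `psi` absorbs the `2πi` of the chain rule. -/
lemma hasDerivAt_psi (r : ℕ) {u : ℂ} (h : 0 < u.im) :
    HasDerivAt (psi (r + 1)) (psi r u) u := by
  set c : ℂ := 2 * Real.pi * I with hc
  have hc0 : c ≠ 0 := two_pi_I_ne
  set ρ := Real.exp (-(2 * Real.pi * (u.im / 2))) with hρ
  have hρ1 : ρ < 1 := exp_neg_lt_one (half_pos h)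
  have hs : Summable fun n : ℕ => ‖(c ^ r)⁻¹‖ * ρ ^ (n + 1) :=
    ((hasSum_pow_succ (Real.exp_pos _).le hρ1).summable).mul_left _
  have hopen : IsOpen {v : ℂ | u.im / 2 < v.im} := isOpen_lt continuous_const continuous_im
  have hder : ∀ (n : ℕ) (v : ℂ), v ∈ {v : ℂ | u.im / 2 < v.im} →
      HasDerivAt (fun v => (c ^ (r + 1))⁻¹ * (ex v ^ (n + 1) / ((n : ℂ) + 1) ^ (r + 1)))
        ((c ^ r)⁻¹ * (ex v ^ (n + 1) / ((n : ℂ) + 1) ^ r)) v := by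
    intro n v _
    have hn : (n : ℂ) + 1 ≠ 0 := Nat.cast_add_one_ne_zero n
    refine ((((hasDerivAt_ex v).fun_pow (n + 1)).div_const _).const_mul _).congr_deriv ?_
    rw [← hc]
    push_cast
    field_simp
    ring
  have hbd : ∀ (n : ℕ) (v : ℂ), v ∈ {v : ℂ | u.im / 2 < v.im} →
      ‖(c ^ r)⁻¹ * (ex v ^ (n + 1) / ((n : ℂ) + 1) ^ r)‖ ≤ ‖(c ^ r)⁻¹‖ * ρ ^ (n + 1) := by
    intro n v hv
    rw [norm_mul]
    gcongr
    refine (norm_polylog_term r _ n).trans ?_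
    gcongr
    exact norm_ex_le (le_of_lt hv)
  have hu : u ∈ {v : ℂ | u.im / 2 < v.im} := by simp only [mem_ofPred_eq]; linarith
  have h0 : Summable fun n : ℕ =>
      (c ^ (r + 1))⁻¹ * (ex u ^ (n + 1) / ((n : ℂ) + 1) ^ (r + 1)) :=
    (Summable.of_norm_bounded (hasSum_pow_succ (norm_nonneg _) (norm_ex_lt_one h)).summable
      (norm_polylog_term (r + 1) (ex u))).mul_left _
  have := hasDerivAt_tsum_of_isPreconnected hs hopen
    (convex_halfSpace_im_gt _).isPreconnected hder hbd hu h0 hu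
  simp only [tsum_mul_left] at this
  exact this

/-! ### Half-lattice sums and their termwise derivatives. -/

/-- The functional `(z, τ) ↦ a z + b τ`. -/
def lin (a b : ℂ) : ℂ × ℂ →L[ℂ] ℂ :=
  a • ContinuousLinearMap.fst ℂ ℂ ℂ + b • ContinuousLinearMap.snd ℂ ℂ ℂ

@[simp] lemma lin_apply (a b : ℂ) (p : ℂ × ℂ) : lin a b p = a * p.1 + b * p.2 := rfl

lemma norm_lin_le (a b : ℂ) : ‖lin a b‖ ≤ ‖a‖ + ‖b‖ := by
  refine ContinuousLinearMap.opNorm_le_bound _ (by positivity) fun p => ?_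
  rw [lin_apply, add_mul]
  refine (norm_add_le _ _).trans ?_
  rw [norm_mul, norm_mul]
  gcongr
  · exact norm_fst_le p
  · exact norm_snd_le p

/-- `∑_{k ≥ K} k^m φ(z + kτ)`. -/
def W (φ : ℂ → ℂ) (K m : ℕ) (p : ℂ × ℂ) : ℂ :=
  ∑' k : ℕ, ((k + K : ℕ) : ℂ) ^ m * φ (p.1 + ((k + K : ℕ) : ℂ) * p.2)

lemma summable_shift_pow_mul_pow (K m : ℕ) {ρ : ℝ} (h0 : 0 < ρ) (h1 : ρ < 1) :
    Summable fun k : ℕ => ((k + K : ℕ) : ℝ) ^ m * ρ ^ (k + 1) := by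
  have h : ‖ρ‖ < 1 := by rwa [Real.norm_of_nonneg h0.le]
  have hs : Summable fun n : ℕ => (n : ℝ) ^ m * ρ ^ n :=
    summable_pow_mul_geometric_of_norm_lt_one m h
  have hs' := ((summable_nat_add_iff (f := fun n : ℕ => (n : ℝ) ^ m * ρ ^ n) K).2 hs).mul_right
    (ρ / ρ ^ K)
  refine hs'.congr fun k => ?_
  have hK : ρ ^ K ≠ 0 := by positivity
  rw [pow_add, pow_succ]
  field_simp

/-- The exponent is `k + 1`: the point `z + Kτ` contributes one `δ` to the imaginary part, and each
of the `k` further steps by `τ` at least one more. -/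
lemma norm_ex_add_mul_le {δ : ℝ} {z τ : ℂ} {K : ℕ} (h1 : δ ≤ τ.im) (h2 : δ ≤ (z + K * τ).im)
    (k : ℕ) : ‖ex (z + ((k + K : ℕ) : ℂ) * τ)‖ ≤ Real.exp (-(2 * Real.pi * δ)) ^ (k + 1) := by
  rw [norm_ex, ← Real.exp_nat_mul]
  gcongr
  simp only [add_im, mul_im, natCast_re, natCast_im, zero_mul, add_zero] at h2 ⊢
  push_cast
  have : (k : ℝ) * δ ≤ k * τ.im := by gcongr
  nlinarith [Real.pi_pos]

lemma le_im_add_mul {δ : ℝ} (hδ : 0 ≤ δ) {z τ : ℂ} {K : ℕ} (h1 : δ ≤ τ.im)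
    (h2 : δ ≤ (z + K * τ).im) (k : ℕ) : δ ≤ (z + ((k + K : ℕ) : ℂ) * τ).im := by
  simp only [add_im, mul_im, natCast_re, natCast_im, zero_mul, add_zero] at h2 ⊢
  push_cast
  have : 0 ≤ k * τ.im := mul_nonneg k.cast_nonneg (hδ.trans h1)
  nlinarith

lemma norm_W_term_le {φ : ℂ → ℂ} {δ C : ℝ} (hδ : 0 ≤ δ)
    (hφ : ∀ u : ℂ, δ ≤ u.im → ‖φ u‖ ≤ C * ‖ex u‖) (hC : 0 ≤ C) {K : ℕ} (m : ℕ) {p : ℂ × ℂ}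
    (h1 : δ ≤ p.2.im) (h2 : δ ≤ (p.1 + K * p.2).im) (k : ℕ) :
    ‖((k + K : ℕ) : ℂ) ^ m * φ (p.1 + ((k + K : ℕ) : ℂ) * p.2)‖ ≤
      C * (((k + K : ℕ) : ℝ) ^ m * Real.exp (-(2 * Real.pi * δ)) ^ (k + 1)) := by
  rw [norm_mul, norm_pow, Complex.norm_natCast, mul_left_comm]
  gcongr
  refine (hφ _ (le_im_add_mul hδ h1 h2 k)).trans ?_
  gcongr
  exact norm_ex_add_mul_le h1 h2 k

lemma exists_between_im {z τ : ℂ} {K : ℕ} (h1 : 0 < τ.im) (h2 : 0 < (z + K * τ).im) :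
    ∃ δ > 0, δ < τ.im ∧ δ < (z + K * τ).im := by
  obtain ⟨δ, h, h'⟩ := exists_between (lt_min h1 h2)
  exact ⟨δ, h, lt_min_iff.1 h'⟩

lemma summable_W {φ : ℂ → ℂ} (hφ : ExpDecay φ) {K : ℕ} (m : ℕ) {p : ℂ × ℂ} (h1 : 0 < p.2.im)
    (h2 : 0 < (p.1 + K * p.2).im) :
    Summable fun k : ℕ => ((k + K : ℕ) : ℂ) ^ m * φ (p.1 + ((k + K : ℕ) : ℂ) * p.2) := by
  obtain ⟨δ, hδ, h1', h2'⟩ := exists_between_im h1 h2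
  obtain ⟨C, hC, hb⟩ := hφ δ hδ
  exact Summable.of_norm_bounded
    ((summable_shift_pow_mul_pow K m (Real.exp_pos _) (exp_neg_lt_one hδ)).mul_left C)
    (norm_W_term_le hδ.le hb hC m h1'.le h2'.le)

lemma hasFDerivAt_comp_linear {φ : ℂ → ℂ} {φ' : ℂ} (c : ℂ) {p : ℂ × ℂ}
    (h : HasDerivAt φ φ' (p.1 + c * p.2)) :
    HasFDerivAt (fun q : ℂ × ℂ => φ (q.1 + c * q.2)) (lin φ' (c * φ')) p := by
  have h1 : HasFDerivAt (fun q : ℂ × ℂ => q.1 + c * q.2) (lin 1 c) p := by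
    have := (lin 1 c).hasFDerivAt (x := p)
    refine this.congr_of_eventuallyEq (Eventually.of_forall fun q => ?_)
    simp
  refine (h.comp_hasFDerivAt p h1).congr_fderiv ?_
  ext <;> simp [mul_comm]

/-- Differentiating `φ(z + kτ)` in `τ` produces a further factor `k`, hence `m + 1`. The bounds are
uniform on an intersection of two real half-spaces, which is convex and so preconnected. -/
lemma hasFDerivAt_W {φ φ' : ℂ → ℂ} (hd : ∀ u : ℂ, 0 < u.im → HasDerivAt φ (φ' u) u)
    (hφ : ExpDecay φ) (hφ' : ExpDecay φ') (K m : ℕ) {p : ℂ × ℂ} (h1 : 0 < p.2.im)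
    (h2 : 0 < (p.1 + K * p.2).im) :
    HasFDerivAt (W φ K m) (lin (W φ' K m p) (W φ' K (m + 1) p)) p := by
  obtain ⟨δ, hδ, h1', h2'⟩ := exists_between_im h1 h2
  obtain ⟨C, hC, hb⟩ := hφ' δ hδ
  set ρ := Real.exp (-(2 * Real.pi * δ)) with hρ
  have hs := ((summable_shift_pow_mul_pow K m (Real.exp_pos _) (exp_neg_lt_one hδ)).mul_left C).add
    ((summable_shift_pow_mul_pow K (m + 1) (Real.exp_pos _) (exp_neg_lt_one hδ)).mul_left C)
  set s : Set (ℂ × ℂ) := {q | δ < q.2.im} ∩ {q | δ < (q.1 + K * q.2).im} with hsdef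
  have hso : IsOpen s := (isOpen_lt (by fun_prop) (by fun_prop)).inter
    (isOpen_lt (by fun_prop) (by fun_prop))
  have hsc : Convex ℝ s := by
    refine (convex_halfSpace_gt ⟨fun x y => by simp, fun c x => by simp⟩ δ).inter
      (convex_halfSpace_gt ⟨fun x y => ?_, fun c x => ?_⟩ δ)
    · simp; ring
    · simp; ring
  have hp : p ∈ s := ⟨h1', h2'⟩
  have hsum := hasFDerivAt_tsum_of_isPreconnected hs hso hsc.isPreconnected
    (f := fun k q => ((k + K : ℕ) : ℂ) ^ m * φ (q.1 + ((k + K : ℕ) : ℂ) * q.2))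
    (f' := fun k q => lin (((k + K : ℕ) : ℂ) ^ m * φ' (q.1 + ((k + K : ℕ) : ℂ) * q.2))
      (((k + K : ℕ) : ℂ) ^ (m + 1) * φ' (q.1 + ((k + K : ℕ) : ℂ) * q.2))) ?_ ?_ hp
      (summable_W hφ m h1 h2) hp
  · refine hsum.congr_fderiv ?_
    have hA := (summable_W hφ' m h1 h2).hasSum
    have hB := (summable_W hφ' (m + 1) h1 h2).hasSum
    refine HasSum.tsum_eq ?_
    exact (hA.smul_const (ContinuousLinearMap.fst ℂ ℂ ℂ)).add
      (hB.smul_const (ContinuousLinearMap.snd ℂ ℂ ℂ))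
  · intro k q hq
    have := (hasFDerivAt_comp_linear ((k + K : ℕ) : ℂ)
      (hd _ (hδ.trans_le (le_im_add_mul hδ.le hq.1.le hq.2.le k)))).const_mul
        (((k + K : ℕ) : ℂ) ^ m)
    refine this.congr_fderiv ?_
    ext
    · simp
    · simp; ring
  · intro k q hq
    exact (norm_lin_le _ _).trans (add_le_add
      (norm_W_term_le hδ.le hb hC m hq.1.le hq.2.le k)
      (norm_W_term_le hδ.le hb hC (m + 1) hq.1.le hq.2.le k))

/-! ### Third-order jets and their calculus. -/

/-- Near `p`, `g` is three times differentiable and its third partial derivatives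
`∂_z^3, ∂_z^2∂_τ, ∂_z∂_τ^2, ∂_τ^3` are `a, b, c, d`. -/
def HasThirdJet (g a b c d : ℂ × ℂ → ℂ) (p : ℂ × ℂ) : Prop :=
  ∃ g1 g2 g11 g12 g22 : ℂ × ℂ → ℂ, ∀ᶠ q in 𝓝 p,
    HasFDerivAt g (lin (g1 q) (g2 q)) q ∧ HasFDerivAt g1 (lin (g11 q) (g12 q)) q ∧
    HasFDerivAt g2 (lin (g12 q) (g22 q)) q ∧ HasFDerivAt g11 (lin (a q) (b q)) q ∧
    HasFDerivAt g12 (lin (b q) (c q)) q ∧ HasFDerivAt g22 (lin (c q) (d q)) q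

lemma lin_add (a b a' b' : ℂ) : lin a b + lin a' b' = lin (a + a') (b + b') := by
  ext <;> simp

lemma lin_smul (k a b : ℂ) : k • lin a b = lin (k * a) (k * b) := by
  ext <;> simp

lemma HasThirdJet.add {g a b c d g' a' b' c' d' : ℂ × ℂ → ℂ} {p : ℂ × ℂ}
    (h : HasThirdJet g a b c d p) (h' : HasThirdJet g' a' b' c' d' p) :
    HasThirdJet (fun q => g q + g' q) (fun q => a q + a' q) (fun q => b q + b' q)
      (fun q => c q + c' q) (fun q => d q + d' q) p := by
  obtain ⟨g1, g2, g11, g12, g22, h⟩ := h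
  obtain ⟨g1', g2', g11', g12', g22', h'⟩ := h'
  refine ⟨fun q => g1 q + g1' q, fun q => g2 q + g2' q, fun q => g11 q + g11' q,
    fun q => g12 q + g12' q, fun q => g22 q + g22' q, ?_⟩
  filter_upwards [h, h'] with q ⟨h1, h2, h3, h4, h5, h6⟩ ⟨k1, k2, k3, k4, k5, k6⟩
  simp only [← lin_add]
  exact ⟨h1.fun_add k1, h2.fun_add k2, h3.fun_add k3, h4.fun_add k4, h5.fun_add k5,
    h6.fun_add k6⟩

lemma HasThirdJet.const_mul {g a b c d : ℂ × ℂ → ℂ} {p : ℂ × ℂ} (k : ℂ)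
    (h : HasThirdJet g a b c d p) :
    HasThirdJet (fun q => k * g q) (fun q => k * a q) (fun q => k * b q)
      (fun q => k * c q) (fun q => k * d q) p := by
  obtain ⟨g1, g2, g11, g12, g22, h⟩ := h
  refine ⟨fun q => k * g1 q, fun q => k * g2 q, fun q => k * g11 q,
    fun q => k * g12 q, fun q => k * g22 q, ?_⟩
  filter_upwards [h] with q ⟨h1, h2, h3, h4, h5, h6⟩
  simp only [← lin_smul]
  exact ⟨h1.const_mul k, h2.const_mul k, h3.const_mul k, h4.const_mul k, h5.const_mul k,
    h6.const_mul k⟩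

lemma HasThirdJet.congr {g a b c d g' a' b' c' d' : ℂ × ℂ → ℂ} {p : ℂ × ℂ}
    (h : HasThirdJet g a b c d p) (hg : g' =ᶠ[𝓝 p] g) (ha : a' =ᶠ[𝓝 p] a) (hb : b' =ᶠ[𝓝 p] b)
    (hc : c' =ᶠ[𝓝 p] c) (hd : d' =ᶠ[𝓝 p] d) : HasThirdJet g' a' b' c' d' p := by
  obtain ⟨g1, g2, g11, g12, g22, h⟩ := h
  refine ⟨g1, g2, g11, g12, g22, ?_⟩
  filter_upwards [h, hg.eventuallyEq_nhds, ha, hb, hc, hd] with q ⟨h1, h2, h3, h4, h5, h6⟩ k ha hb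
    hc hd
  rw [ha, hb, hc, hd]
  exact ⟨h1.congr_of_eventuallyEq k, h2, h3, h4, h5, h6⟩

lemma HasThirdJet.congr_left {g a b c d g' : ℂ × ℂ → ℂ} {p : ℂ × ℂ}
    (h : HasThirdJet g a b c d p) (hg : g' =ᶠ[𝓝 p] g) : HasThirdJet g' a b c d p :=
  h.congr hg .rfl .rfl .rfl .rfl

lemma HasThirdJet.eventually {g a b c d : ℂ × ℂ → ℂ} {p : ℂ × ℂ}
    (h : HasThirdJet g a b c d p) : ∀ᶠ q in 𝓝 p, HasThirdJet g a b c d q := by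
  obtain ⟨g1, g2, g11, g12, g22, h⟩ := h
  filter_upwards [h.eventually_nhds] with q hq
  exact ⟨g1, g2, g11, g12, g22, hq⟩

lemma HasThirdJet.differentiableAt {g a b c d : ℂ × ℂ → ℂ} {p : ℂ × ℂ}
    (h : HasThirdJet g a b c d p) : DifferentiableAt ℂ g p := by
  obtain ⟨g1, g2, g11, g12, g22, h⟩ := h
  exact h.self_of_nhds.1.differentiableAt

/-- Pullback along `(z, τ) ↦ (εz, τ)`. -/
lemma HasThirdJet.comp_scale {g a b c d : ℂ × ℂ → ℂ} {p : ℂ × ℂ} (ε : ℂ)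
    (h : HasThirdJet g a b c d (ε * p.1, p.2)) :
    HasThirdJet (fun q => g (ε * q.1, q.2)) (fun q => ε ^ 3 * a (ε * q.1, q.2))
      (fun q => ε ^ 2 * b (ε * q.1, q.2)) (fun q => ε * c (ε * q.1, q.2))
      (fun q => d (ε * q.1, q.2)) p := by
  obtain ⟨g1, g2, g11, g12, g22, h⟩ := h
  have hl : ∀ q : ℂ × ℂ, HasFDerivAt (fun q : ℂ × ℂ => (ε * q.1, q.2))
      ((lin ε 0).prod (lin 0 1)) q := fun q => by
    have := ((lin ε 0).prod (lin 0 1)).hasFDerivAt (x := q)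
    refine this.congr_of_eventuallyEq (Eventually.of_forall fun q => ?_)
    simp
  have key : ∀ (k : ℂ) (f : ℂ × ℂ → ℂ) (x y : ℂ) (q : ℂ × ℂ),
      HasFDerivAt f (lin x y) (ε * q.1, q.2) →
      HasFDerivAt (fun q : ℂ × ℂ => k * f (ε * q.1, q.2)) (lin (k * ε * x) (k * y)) q := by
    intro k f x y q hf
    refine ((hf.comp q (hl q)).const_mul k).congr_fderiv ?_
    ext
    · simp; ring
    · simp
  refine ⟨fun q => ε * g1 (ε * q.1, q.2), fun q => 1 * g2 (ε * q.1, q.2),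
    fun q => ε ^ 2 * g11 (ε * q.1, q.2), fun q => ε * g12 (ε * q.1, q.2),
    fun q => 1 * g22 (ε * q.1, q.2), ?_⟩
  have ht : Tendsto (fun q : ℂ × ℂ => (ε * q.1, q.2)) (𝓝 p) (𝓝 (ε * p.1, p.2)) :=
    (hl p).continuousAt
  filter_upwards [ht.eventually h] with q ⟨h1, h2, h3, h4, h5, h6⟩
  have k1 := key 1 _ _ _ q h1
  have k2 := key ε _ _ _ q h2
  have k3 := key 1 _ _ _ q h3
  have k4 := key (ε ^ 2) _ _ _ q h4
  have k5 := key ε _ _ _ q h5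
  have k6 := key 1 _ _ _ q h6
  simp only [one_mul] at k1 k3 k6 ⊢
  refine ⟨k1, ?_, k3, ?_, ?_, k6⟩
  · convert k2 using 2; ring
  · convert k4 using 2; ring
  · convert k5 using 2; ring

/-- Functions of the linear form `z + cτ`. -/
lemma hasThirdJet_comp_linear {φ φ1 φ2 φ3 : ℂ → ℂ} (c : ℂ) {p : ℂ × ℂ}
    (h : ∀ᶠ u in 𝓝 (p.1 + c * p.2),
      HasDerivAt φ (φ1 u) u ∧ HasDerivAt φ1 (φ2 u) u ∧ HasDerivAt φ2 (φ3 u) u) :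
    HasThirdJet (fun q => φ (q.1 + c * q.2)) (fun q => φ3 (q.1 + c * q.2))
      (fun q => c * φ3 (q.1 + c * q.2)) (fun q => c ^ 2 * φ3 (q.1 + c * q.2))
      (fun q => c ^ 3 * φ3 (q.1 + c * q.2)) p := by
  refine ⟨fun q => φ1 (q.1 + c * q.2), fun q => c * φ1 (q.1 + c * q.2),
    fun q => φ2 (q.1 + c * q.2), fun q => c * φ2 (q.1 + c * q.2),
    fun q => c ^ 2 * φ2 (q.1 + c * q.2), ?_⟩
  have ht : Tendsto (fun q : ℂ × ℂ => q.1 + c * q.2) (𝓝 p) (𝓝 (p.1 + c * p.2)) :=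
    Continuous.tendsto (by fun_prop) p
  filter_upwards [ht.eventually h] with q ⟨h1, h2, h3⟩
  have k1 := hasFDerivAt_comp_linear c h1
  have k2 := hasFDerivAt_comp_linear c h2
  have k3 := hasFDerivAt_comp_linear c h3
  refine ⟨k1, k2, ?_, k3, ?_, ?_⟩
  · exact ((k2.const_mul c).congr_fderiv (lin_smul _ _ _)).congr_fderiv (by congr 1; ring)
  · exact ((k3.const_mul c).congr_fderiv (lin_smul _ _ _)).congr_fderiv (by congr 1; ring)
  · exact ((k3.const_mul (c ^ 2)).congr_fderiv (lin_smul _ _ _)).congr_fderiv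
      (by congr 1; ring)

lemma hasThirdJet_W_psi (K : ℕ) {p : ℂ × ℂ} (h1 : 0 < p.2.im) (h2 : 0 < (p.1 + K * p.2).im) :
    HasThirdJet (W (psi 3) K 0) (W L0 K 0) (W L0 K 1) (W L0 K 2) (W L0 K 3) p := by
  refine ⟨W (psi 2) K 0, W (psi 2) K 1, W (psi 1) K 0, W (psi 1) K 1, W (psi 1) K 2, ?_⟩
  have e1 : ∀ᶠ q : ℂ × ℂ in 𝓝 p, 0 < q.2.im :=
    (isOpen_lt continuous_const (by fun_prop)).mem_nhds h1
  have e2 : ∀ᶠ q : ℂ × ℂ in 𝓝 p, 0 < (q.1 + K * q.2).im :=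
    (isOpen_lt continuous_const (by fun_prop)).mem_nhds h2
  filter_upwards [e1, e2] with q h1 h2
  have key : ∀ r m, HasFDerivAt (W (psi (r + 1)) K m) (lin (W (psi r) K m q)
      (W (psi r) K (m + 1) q)) q := fun r m =>
    hasFDerivAt_W (fun u hu => hasDerivAt_psi r hu) (expDecay_psi _) (expDecay_psi _) K m h1 h2
  have key0 : ∀ m, HasFDerivAt (W (psi 1) K m) (lin (W L0 K m q) (W L0 K (m + 1) q)) q :=
    fun m => hasFDerivAt_W (fun u hu => (hasDerivAt_psi 0 hu).congr_deriv (psi_zero hu))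
      (expDecay_psi _) expDecay_L0 K m h1 h2
  exact ⟨key 2 0, key 1 0, key 1 1, key0 0, key0 1, key0 2⟩

/-! ### Polynomials of low degree. -/

lemma hasFDerivAt_fst_sub (z : ℂ) (q : ℂ × ℂ) :
    HasFDerivAt (fun q : ℂ × ℂ => q.1 - z) (lin 1 0) q := by
  refine (hasFDerivAt_fst.sub_const z).congr_fderiv ?_
  ext <;> simp

lemma hasFDerivAt_snd_sub (z : ℂ) (q : ℂ × ℂ) :
    HasFDerivAt (fun q : ℂ × ℂ => q.2 - z) (lin 0 1) q := by
  refine (hasFDerivAt_snd.sub_const z).congr_fderiv ?_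
  ext <;> simp

lemma hasFDerivAt_affine (p₀ : ℂ × ℂ) (k k1 k2 : ℂ) (q : ℂ × ℂ) :
    HasFDerivAt (fun q : ℂ × ℂ => k + k1 * (q.1 - p₀.1) + k2 * (q.2 - p₀.2)) (lin k1 k2) q := by
  refine (((hasFDerivAt_const k q).fun_add ((hasFDerivAt_fst_sub p₀.1 q).const_mul k1)).fun_add
    ((hasFDerivAt_snd_sub p₀.2 q).const_mul k2)).congr_fderiv ?_
  ext <;> simp

/-- A polynomial of degree two with prescribed derivatives at `p₀`. -/
def quadratic (p₀ : ℂ × ℂ) (k k1 k2 k11 k12 k22 : ℂ) (q : ℂ × ℂ) : ℂ :=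
  k + k1 * (q.1 - p₀.1) + k2 * (q.2 - p₀.2) + k11 * (q.1 - p₀.1) ^ 2 / 2
    + k12 * ((q.1 - p₀.1) * (q.2 - p₀.2)) + k22 * (q.2 - p₀.2) ^ 2 / 2

lemma hasFDerivAt_quadratic (p₀ : ℂ × ℂ) (k k1 k2 k11 k12 k22 : ℂ) (q : ℂ × ℂ) :
    HasFDerivAt (quadratic p₀ k k1 k2 k11 k12 k22)
      (lin (k1 + k11 * (q.1 - p₀.1) + k12 * (q.2 - p₀.2))
        (k2 + k12 * (q.1 - p₀.1) + k22 * (q.2 - p₀.2))) q := by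
  have hx := hasFDerivAt_fst_sub p₀.1 q
  have hy := hasFDerivAt_snd_sub p₀.2 q
  refine ((((hasFDerivAt_affine p₀ k k1 k2 q).fun_add
      (((hx.pow 2).const_mul k11).mul_const 2⁻¹)).fun_add
      ((hx.fun_mul hy).const_mul k12)).fun_add
      (((hy.pow 2).const_mul k22).mul_const 2⁻¹)).congr_fderiv ?_
  ext
  · simp; ring
  · simp; ring

lemma hasFDerivAt_const_lin (x : ℂ) (q : ℂ × ℂ) :
    HasFDerivAt (fun _ : ℂ × ℂ => x) (lin 0 0) q :=
  (hasFDerivAt_const x q).congr_fderiv (by ext <;> simp)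

lemma hasThirdJet_quadratic (p₀ : ℂ × ℂ) (k k1 k2 k11 k12 k22 : ℂ) (p : ℂ × ℂ) :
    HasThirdJet (quadratic p₀ k k1 k2 k11 k12 k22) 0 0 0 0 p :=
  ⟨_, _, fun _ => k11, fun _ => k12, fun _ => k22, Eventually.of_forall fun q =>
    ⟨hasFDerivAt_quadratic p₀ k k1 k2 k11 k12 k22 q, hasFDerivAt_affine p₀ k1 k11 k12 q,
      hasFDerivAt_affine p₀ k2 k12 k22 q, hasFDerivAt_const_lin _ q, hasFDerivAt_const_lin _ q,
      hasFDerivAt_const_lin _ q⟩⟩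

/-- The cubic polynomial part of the elliptic trilogarithm. -/
def cubicPart (q : ℂ × ℂ) : ℂ := q.1 ^ 3 / 12 - q.1 ^ 2 * q.2 / 24

lemma hasThirdJet_cubicPart (p : ℂ × ℂ) :
    HasThirdJet cubicPart (fun _ => 1 / 2) (fun _ => -1 / 12) 0 0 p := by
  refine ⟨fun q => q.1 ^ 2 / 4 - q.1 * q.2 / 12, fun q => - q.1 ^ 2 / 24,
    fun q => q.1 / 2 - q.2 / 12, fun q => - q.1 / 12, 0, Eventually.of_forall fun q => ?_⟩
  have hx : HasFDerivAt (fun q : ℂ × ℂ => q.1) (lin 1 0) q := by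
    simpa using hasFDerivAt_fst_sub 0 q
  have hy : HasFDerivAt (fun q : ℂ × ℂ => q.2) (lin 0 1) q := by
    simpa using hasFDerivAt_snd_sub 0 q
  refine ⟨?_, ?_, ?_, ?_, ?_, ?_⟩
  · refine (((hx.pow 3).mul_const 12⁻¹).fun_sub
      (((hx.pow 2).fun_mul hy).mul_const 24⁻¹)).congr_fderiv ?_
    ext
    · simp; ring
    · simp; ring
  · refine (((hx.pow 2).mul_const 4⁻¹).fun_sub
      ((hx.fun_mul hy).mul_const 12⁻¹)).congr_fderiv ?_
    ext
    · simp; ring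
    · simp; ring
  · refine ((hx.pow 2).fun_neg.mul_const 24⁻¹).congr_fderiv ?_
    ext
    · simp; ring
    · simp
  · refine ((hx.mul_const 2⁻¹).fun_sub (hy.mul_const 12⁻¹)).congr_fderiv ?_
    ext
    · simp
    · simp; ring
  · refine (hx.fun_neg.mul_const 12⁻¹).congr_fderiv ?_
    ext
    · simp; ring
    · simp
  · exact hasFDerivAt_const_lin 0 q

/-! ### Uniqueness and extension of functions with a given third jet. -/

lemma eqOn_of_hasFDerivAt {f g : ℂ × ℂ → ℂ} {p : ℂ × ℂ} {r : ℝ} {L : ℂ × ℂ → ℂ × ℂ →L[ℂ] ℂ}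
    (hf : ∀ q ∈ Metric.ball p r, HasFDerivAt f (L q) q)
    (hg : ∀ q ∈ Metric.ball p r, HasFDerivAt g (L q) q) (h0 : f p = g p) :
    ∀ q ∈ Metric.ball p r, f q = g q := by
  intro q hq
  have hr : p ∈ Metric.ball p r := Metric.mem_ball_self (Metric.pos_of_mem_ball hq)
  exact Metric.isOpen_ball.eqOn_of_fderiv_eq (convex_ball p r).isPreconnected
    (fun x hx => (hf x hx).differentiableAt.differentiableWithinAt)
    (fun x hx => (hg x hx).differentiableAt.differentiableWithinAt)
    (fun x hx => (hf x hx).fderiv.trans (hg x hx).fderiv.symm) hr h0 hq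

/-- If all third derivatives vanish near `p`, the function is a polynomial of degree two. -/
lemma HasThirdJet.eq_quadratic {g : ℂ × ℂ → ℂ} {p : ℂ × ℂ} (h : HasThirdJet g 0 0 0 0 p) :
    ∃ k k1 k2 k11 k12 k22, g =ᶠ[𝓝 p] quadratic p k k1 k2 k11 k12 k22 := by
  obtain ⟨g1, g2, g11, g12, g22, h⟩ := h
  obtain ⟨r, hr, hb⟩ := Metric.eventually_nhds_iff_ball.1 h
  have e11 := eqOn_of_hasFDerivAt (fun q hq => (hb q hq).2.2.2.1)
    (fun q _ => hasFDerivAt_const_lin (g11 p) q) rfl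
  have e12 := eqOn_of_hasFDerivAt (fun q hq => (hb q hq).2.2.2.2.1)
    (fun q _ => hasFDerivAt_const_lin (g12 p) q) rfl
  have e22 := eqOn_of_hasFDerivAt (fun q hq => (hb q hq).2.2.2.2.2)
    (fun q _ => hasFDerivAt_const_lin (g22 p) q) rfl
  have e1 := eqOn_of_hasFDerivAt (L := fun _ => lin (g11 p) (g12 p))
    (fun q hq => (hb q hq).2.1.congr_fderiv (by rw [e11 q hq, e12 q hq]))
    (fun q _ => hasFDerivAt_affine p (g1 p) (g11 p) (g12 p) q) (by simp)
  have e2 := eqOn_of_hasFDerivAt (L := fun _ => lin (g12 p) (g22 p))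
    (fun q hq => (hb q hq).2.2.1.congr_fderiv (by rw [e12 q hq, e22 q hq]))
    (fun q _ => hasFDerivAt_affine p (g2 p) (g12 p) (g22 p) q) (by simp)
  have e := eqOn_of_hasFDerivAt
    (fun q hq => (hb q hq).1.congr_fderiv (by rw [e1 q hq, e2 q hq]))
    (fun q _ => hasFDerivAt_quadratic p (g p) (g1 p) (g2 p) (g11 p) (g12 p) (g22 p) q)
    (by simp [quadratic])
  exact ⟨_, _, _, _, _, _, eventually_of_mem (Metric.ball_mem_nhds p hr) e⟩

/-- The difference `g - H` has zero third jet near `p'`, so it is quadratic there. That polynomial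
is defined everywhere, and adding it to `H` leaves the jet unchanged on the whole ball. -/
lemma exists_extension {H g a b c d : ℂ × ℂ → ℂ} {p p' : ℂ × ℂ} {r : ℝ}
    (hH : ∀ q ∈ Metric.ball p r, HasThirdJet H a b c d q) (hp' : p' ∈ Metric.ball p r)
    (hg : HasThirdJet g a b c d p') :
    ∃ h, (∀ q ∈ Metric.ball p r, HasThirdJet h a b c d q) ∧ g =ᶠ[𝓝 p'] h := by
  have h0 : ∀ f : ℂ × ℂ → ℂ, (0 : ℂ × ℂ → ℂ) =ᶠ[𝓝 p'] fun q => f q + -1 * f q := fun f =>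
    Eventually.of_forall fun q => by simp
  obtain ⟨k, k1, k2, k11, k12, k22, hq⟩ := ((hg.add ((hH p' hp').const_mul (-1))).congr .rfl
    (h0 a) (h0 b) (h0 c) (h0 d)).eq_quadratic
  refine ⟨fun q => H q + quadratic p' k k1 k2 k11 k12 k22 q, fun q hq => ?_, ?_⟩
  · have h0' : ∀ f : ℂ × ℂ → ℂ, f =ᶠ[𝓝 q] fun q => f q + (0 : ℂ × ℂ → ℂ) q := fun f =>
      Eventually.of_forall fun q => by simp
    exact ((hH q hq).add (hasThirdJet_quadratic p' k k1 k2 k11 k12 k22 q)).congr .rfl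
      (h0' a) (h0' b) (h0' c) (h0' d)
  · filter_upwards [hq] with q hq
    rw [← hq]; ring

/-- The identity theorem on balls of `ℂ × ℂ`. -/
lemma eqOn_ball_of_eventuallyEq {f g : ℂ × ℂ → ℂ} {p p' : ℂ × ℂ} {r : ℝ}
    (hf : ∀ q ∈ Metric.ball p r, DifferentiableAt ℂ f q)
    (hg : ∀ q ∈ Metric.ball p r, DifferentiableAt ℂ g q) (hp' : p' ∈ Metric.ball p r)
    (h : f =ᶠ[𝓝 p'] g) : EqOn f g (Metric.ball p r) := by
  intro w hw
  -- Restriction to the complex line through `p'` and `w` reduces the claim to the one-variable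
  -- identity theorem. Since `ℓ` is affine, the preimage of the ball is convex.
  set ℓ : ℂ → ℂ × ℂ := fun t => p' + t • (w - p') with hℓ
  have hℓd : Differentiable ℂ ℓ := by fun_prop
  have hUo : IsOpen (ℓ ⁻¹' Metric.ball p r) := Metric.isOpen_ball.preimage hℓd.continuous
  have hUc : Convex ℝ (ℓ ⁻¹' Metric.ball p r) := by
    intro x hx y hy s t hs ht hst
    have : ℓ (s • x + t • y) = s • ℓ x + t • ℓ y := by
      have hst' : (s : ℂ) + t = 1 := by exact_mod_cast hst
      have e : ∀ P : ℂ × ℂ, P = (s : ℂ) • P + (t : ℂ) • P := fun P => by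
        rw [← add_smul, hst', one_smul]
      simp only [hℓ, RCLike.real_smul_eq_coe_smul (K := ℂ) s,
        RCLike.real_smul_eq_coe_smul (K := ℂ) t, coe_algebraMap]
      nth_rewrite 1 [e p']
      simp only [smul_add, add_smul, smul_smul]
      simp only [smul_eq_mul]
      abel
    simp only [mem_preimage, this]
    exact convex_ball p r hx hy hs ht hst
  have hF : ∀ F : ℂ × ℂ → ℂ, (∀ q ∈ Metric.ball p r, DifferentiableAt ℂ F q) →
      AnalyticOnNhd ℂ (F ∘ ℓ) (ℓ ⁻¹' Metric.ball p r) := fun F hF =>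
    DifferentiableOn.analyticOnNhd
      (fun t ht => ((hF _ ht).comp t (hℓd t)).differentiableWithinAt) hUo
  have h0 : ℓ 0 = p' := by simp [hℓ]
  have h1 : ℓ 1 = w := by simp [hℓ]
  have hev : f ∘ ℓ =ᶠ[𝓝 0] g ∘ ℓ := by
    have ht : Tendsto ℓ (𝓝 0) (𝓝 p') := by
      have := hℓd.continuous.tendsto 0
      rwa [h0] at this
    exact ht.eventually h
  have := (hF f hf).eqOn_of_preconnected_of_eventuallyEq (hF g hg) hUc.isPreconnected
    (by rw [mem_preimage, h0]; exact hp') hev (show (1 : ℂ) ∈ _ by rw [mem_preimage, h1]; exact hw)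
  simpa [h1] using this

section PartialDerivatives

variable {g f a b : ℂ × ℂ → ℂ} {p : ℂ × ℂ} {n m : ℕ}

lemma hasDerivAt_fst_of_lin {x y : ℂ} {q : ℂ × ℂ} (h : HasFDerivAt f (lin x y) q) :
    HasDerivAt (fun z => f (z, q.2)) x q.1 := by
  have := HasFDerivAt.comp_hasDerivAt (f := fun z => (z, q.2)) q.1 h
    ((hasDerivAt_id q.1).prodMk (hasDerivAt_const q.1 q.2))
  simpa using! this

lemma hasDerivAt_snd_of_lin {x y : ℂ} {q : ℂ × ℂ} (h : HasFDerivAt f (lin x y) q) :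
    HasDerivAt (fun τ => f (q.1, τ)) y q.2 := by
  have := HasFDerivAt.comp_hasDerivAt (f := fun τ => (q.1, τ)) q.2 h
    ((hasDerivAt_const q.2 q.1).prodMk (hasDerivAt_id q.2))
  simpa using! this

lemma eventually_pd_zero_zero : ∀ᶠ q in 𝓝 p, pd 0 0 g q.1 q.2 = g q :=
  Eventually.of_forall fun q => by simp [pd]

lemma eventually_pd_tau (h : ∀ᶠ q in 𝓝 p, pd 0 n g q.1 q.2 = f q)
    (hf : ∀ᶠ q in 𝓝 p, HasFDerivAt f (lin (a q) (b q)) q) :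
    ∀ᶠ q in 𝓝 p, pd 0 (n + 1) g q.1 q.2 = b q := by
  filter_upwards [h.eventually_nhds, hf] with q h hf
  have ht : Tendsto (fun τ => (q.1, τ)) (𝓝 q.2) (𝓝 q) := Continuous.tendsto (by fun_prop) q.2
  have he : (fun τ => iteratedDeriv n (fun τ' => g (q.1, τ')) τ) =ᶠ[𝓝 q.2]
      fun τ => f (q.1, τ) := by
    filter_upwards [ht.eventually h] with τ hτ
    simpa [pd] using hτ
  simp only [pd, iteratedDeriv_zero, iteratedDeriv_succ]
  exact he.deriv_eq.trans (hasDerivAt_snd_of_lin hf).deriv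

lemma eventually_pd_z (h : ∀ᶠ q in 𝓝 p, pd n m g q.1 q.2 = f q)
    (hf : ∀ᶠ q in 𝓝 p, HasFDerivAt f (lin (a q) (b q)) q) :
    ∀ᶠ q in 𝓝 p, pd (n + 1) m g q.1 q.2 = a q := by
  filter_upwards [h.eventually_nhds, hf] with q h hf
  have ht : Tendsto (fun z => (z, q.2)) (𝓝 q.1) (𝓝 q) := Continuous.tendsto (by fun_prop) q.1
  have he : (fun z => pd n m g z q.2) =ᶠ[𝓝 q.1] fun z => f (z, q.2) := ht.eventually h
  rw [pd, iteratedDeriv_succ]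
  exact he.deriv_eq.trans (hasDerivAt_fst_of_lin hf).deriv

end PartialDerivatives

lemma HasThirdJet.pd_eq {g a b c d : ℂ × ℂ → ℂ} {z τ : ℂ} (h : HasThirdJet g a b c d (z, τ)) :
    pd 3 0 g z τ = a (z, τ) ∧ pd 2 1 g z τ = b (z, τ) ∧ pd 1 2 g z τ = c (z, τ) ∧
      pd 0 3 g z τ = d (z, τ) := by
  obtain ⟨g1, g2, g11, g12, g22, h⟩ := h
  simp only [eventually_and] at h
  obtain ⟨h1, h2, h3, h4, h5, h6⟩ := h
  have k0 := eventually_pd_zero_zero (g := g) (p := (z, τ))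
  have k1 := eventually_pd_tau k0 h1
  have k2 := eventually_pd_tau k1 h3
  exact ⟨(eventually_pd_z (eventually_pd_z (eventually_pd_z k0 h1) h2) h4).self_of_nhds,
    (eventually_pd_z (eventually_pd_z k1 h3) h5).self_of_nhds,
    (eventually_pd_z k2 h6).self_of_nhds, (eventually_pd_tau k2 h6).self_of_nhds⟩

/-! ### The third derivatives of the trilogarithm. -/

/-- `f^{(3,0)}` as a single-valued function. -/
def fA (q : ℂ × ℂ) : ℂ := W L0 0 0 q - W L0 1 0 (-q.1, q.2) + 1 / 2

/-- `f^{(2,1)}` as a single-valued function. -/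
def fB (q : ℂ × ℂ) : ℂ := W L0 0 1 q + W L0 1 1 (-q.1, q.2) - 1 / 12

/-- `f^{(1,2)}` as a single-valued function. -/
def fC (q : ℂ × ℂ) : ℂ := W L0 0 2 q - W L0 1 2 (-q.1, q.2)

/-- `f^{(0,3)}` as a single-valued function. -/
def fD (q : ℂ × ℂ) : ℂ := W L0 0 3 q + W L0 1 3 (-q.1, q.2) - 2 * W L0 1 3 (0, q.2)

/-- `H₀` and `H₁` are left abstract: in the strip they are the polylogarithm sums, at other regular
points only local primitives. Scaling by `-1` gives the terms in `-z`; scaling by `0` handles the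
term free of `z`, which contributes only to `∂_τ^3`. -/
lemma hasThirdJet_assemble {H₀ H₁ : ℂ × ℂ → ℂ} {p : ℂ × ℂ} (hp : 0 < p.2.im)
    (h₀ : HasThirdJet H₀ (W L0 0 0) (W L0 0 1) (W L0 0 2) (W L0 0 3) p)
    (h₁ : HasThirdJet H₁ (W L0 1 0) (W L0 1 1) (W L0 1 2) (W L0 1 3) (-p.1, p.2)) :
    HasThirdJet (fun q => H₀ q + H₁ (-q.1, q.2) + cubicPart q - 2 * W (psi 3) 1 0 (0, q.2))
      fA fB fC fD p := by
  have h₁' := HasThirdJet.comp_scale (p := p) (-1) (by rwa [neg_one_mul])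
  have h₂ := HasThirdJet.comp_scale (p := p) 0
    (hasThirdJet_W_psi 1 (p := (0 * p.1, p.2)) hp (by simpa using hp))
  refine (((h₀.add h₁').add (hasThirdJet_cubicPart p)).add (h₂.const_mul (-2))).congr ?_ ?_ ?_ ?_ ?_
  all_goals refine Eventually.of_forall fun q => ?_
  all_goals simp [fA, fB, fC, fD]
  all_goals ring

/-- In the difference of the two `chi`, the term `j = 3` is free of `z` and cancels, the term `j =
2` vanishes because `B_3 = 0`, and the rest gives `cubicPart`. The `n = 0` term of the series at `z
= 0` leaves the constant `Li_3(1)`. -/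
lemma trilogSeries_eq {q : ℂ × ℂ} (hq : 0 < q.2.im) :
    trilogSeries q = W (psi 3) 0 0 q + W (psi 3) 1 0 (-q.1, q.2) + cubicPart q
      - 2 * W (psi 3) 1 0 (0, q.2) - ((2 * Real.pi * I) ^ 3)⁻¹ * polylog 3 1 := by
  have hc := two_pi_I_ne
  have e0 : ∀ z, W (psi 3) 0 0 (z, q.2) = ((2 * Real.pi * I) ^ 3)⁻¹ *
      ∑' n : ℕ, polylog 3 (ex q.2 ^ n * ex z) := fun z => by
    rw [W, ← tsum_mul_left]
    refine tsum_congr fun n => ?_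
    simp only [psi, ex_add, ex_nat_mul, pow_zero, one_mul, add_zero]
    rw [mul_comm (ex z)]
  have e1 : ∀ z, W (psi 3) 1 0 (-z, q.2) = ((2 * Real.pi * I) ^ 3)⁻¹ *
      ∑' n : ℕ, polylog 3 (ex q.2 ^ (n + 1) * (ex z)⁻¹) := fun z => by
    rw [W, ← tsum_mul_left]
    refine tsum_congr fun n => ?_
    simp only [psi, ex_add, ex_nat_mul, ex_neg, pow_zero, one_mul]
    rw [mul_comm (ex z)⁻¹]
  have hex0 : ex 0 = 1 := by simp [ex]
  have hsum : Summable fun n : ℕ => polylog 3 (ex q.2 ^ (n + 1)) := by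
    have := (summable_W (expDecay_psi 3) (K := 1) 0 (p := (0, q.2)) hq (by simpa using hq)).mul_left
      ((2 * Real.pi * I) ^ 3 : ℂ)
    refine this.congr fun n => ?_
    simp only [psi, pow_zero, one_mul, zero_add, ex_nat_mul]
    field_simp
  have e2 : ∑' n : ℕ, polylog 3 (ex q.2 ^ n * 1) =
      polylog 3 1 + ∑' n : ℕ, polylog 3 (ex q.2 ^ (n + 1)) := by
    simp only [mul_one]
    rw [← ((summable_nat_add_iff (f := fun n => polylog 3 (ex q.2 ^ n)) 1).1 hsum).sum_add_tsum_nat_add 1]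
    simp
  have hchi : chi 3 q.1 q.2 - chi 3 0 q.2 = - (2 * Real.pi * I) ^ 3 * cubicPart q := by
    simp only [chi, cubicPart, Finset.sum_range_succ, Finset.sum_range_zero]
    have b3 : bernoulli 3 = 0 := by
      rw [bernoulli_eq_bernoulli'_of_ne_one (by norm_num)]; simp
    simp [b3, Nat.factorial]
    ring
  have hz : W (psi 3) 1 0 (0, q.2) = ((2 * Real.pi * I) ^ 3)⁻¹ *
      ∑' n : ℕ, polylog 3 (ex q.2 ^ (n + 1)) := by
    simpa [hex0] using e1 0
  have hE : ∀ z, ellipticPolylog 3 z q.2 = (∑' n : ℕ, polylog 3 (ex q.2 ^ n * ex z)) +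
      (∑' n : ℕ, polylog 3 (ex q.2 ^ (n + 1) * (ex z)⁻¹)) - chi 3 z q.2 := fun z => rfl
  have hq' : W (psi 3) 0 0 q = W (psi 3) 0 0 (q.1, q.2) := rfl
  rw [trilogSeries, hE, hE, hex0, e2, hq', e0, e1, hz]
  simp only [inv_one, mul_one]
  have : chi 3 q.1 q.2 = chi 3 0 q.2 - (2 * Real.pi * I) ^ 3 * cubicPart q := by
    linear_combination hchi
  rw [this]
  linear_combination cubicPart q * inv_mul_cancel₀ (pow_ne_zero 3 hc)

lemma hasThirdJet_trilogSeries {p : ℂ × ℂ} (hp : p ∈ strip) :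
    HasThirdJet trilogSeries fA fB fC fD p := by
  have hτ : 0 < p.2.im := hp.1.trans hp.2
  have h := hasThirdJet_assemble hτ
    (hasThirdJet_W_psi 0 hτ (by simpa using hp.1))
    (hasThirdJet_W_psi 1 hτ (by simpa using hp.2))
  have hc := hasThirdJet_quadratic p (-(((2 * Real.pi * I) ^ 3)⁻¹ * polylog 3 1)) 0 0 0 0 0 p
  have h0 : ∀ f : ℂ × ℂ → ℂ, f =ᶠ[𝓝 p] fun q => f q + (0 : ℂ × ℂ → ℂ) q := fun f =>
    Eventually.of_forall fun q => by simp
  refine (h.add hc).congr ?_ (h0 fA) (h0 fB) (h0 fC) (h0 fD)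
  have : ∀ᶠ q : ℂ × ℂ in 𝓝 p, 0 < q.2.im :=
    (isOpen_lt continuous_const (by fun_prop)).mem_nhds hτ
  filter_upwards [this] with q hq
  rw [trilogSeries_eq hq, quadratic]
  ring

/-! ### Local primitives at regular points. -/

lemma L0_differentiableAt {u : ℂ} (h : ∀ n : ℤ, u ≠ n) : DifferentiableAt ℂ L0 u :=
  (hasDerivAt_L0 h).differentiableAt

lemma isOpen_ne_int : IsOpen {u : ℂ | ∀ n : ℤ, u ≠ n} := by
  have : {u : ℂ | ∀ n : ℤ, u ≠ n} = {u | ex u ≠ 1} := by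
    ext u
    simp [ex_eq_one_iff]
  rw [this]
  exact isOpen_ne_fun (continuous_iff_continuousAt.2 fun u => (hasDerivAt_ex u).continuousAt)
    continuous_const

/-- Local threefold primitives of `L0`. -/
lemma exists_primitive_L0 {u₀ : ℂ} (h : ∀ n : ℤ, u₀ ≠ n) :
    ∃ φ φ1 φ2 : ℂ → ℂ, ∀ᶠ u in 𝓝 u₀,
      HasDerivAt φ (φ1 u) u ∧ HasDerivAt φ1 (φ2 u) u ∧ HasDerivAt φ2 (L0 u) u := by
  obtain ⟨r, hr, hb⟩ := Metric.isOpen_iff.1 isOpen_ne_int u₀ h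
  have hd : DifferentiableOn ℂ L0 (Metric.ball u₀ r) := fun u hu =>
    (L0_differentiableAt (hb hu)).differentiableWithinAt
  obtain ⟨φ2, h2⟩ := hd.isExactOn_ball
  obtain ⟨φ1, h1⟩ := DifferentiableOn.isExactOn_ball (f := φ2) fun u hu =>
    (h2 u hu).differentiableAt.differentiableWithinAt
  obtain ⟨φ, h0⟩ := DifferentiableOn.isExactOn_ball (f := φ1) fun u hu =>
    (h1 u hu).differentiableAt.differentiableWithinAt
  exact ⟨φ, φ1, φ2, eventually_of_mem (Metric.ball_mem_nhds u₀ hr) fun u hu =>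
    ⟨h0 u hu, h1 u hu, h2 u hu⟩⟩

lemma summable_L0_tail {J N m : ℕ} {q : ℂ × ℂ} (h1 : 0 < q.2.im)
    (h2 : 0 < (q.1 + (N + J : ℕ) * q.2).im) :
    Summable fun k : ℕ => ((k + N + J : ℕ) : ℂ) ^ m * L0 (q.1 + ((k + N + J : ℕ) : ℂ) * q.2) := by
  simpa only [add_assoc] using summable_W expDecay_L0 (K := N + J) m h1 h2

lemma W_L0_split {J N m : ℕ} {q : ℂ × ℂ} (h1 : 0 < q.2.im)
    (h2 : 0 < (q.1 + (N + J : ℕ) * q.2).im) :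
    W L0 J m q = ∑ k ∈ Finset.range N,
      ((k + J : ℕ) : ℂ) ^ m * L0 (q.1 + ((k + J : ℕ) : ℂ) * q.2) + W L0 (N + J) m q := by
  have := Summable.sum_add_tsum_nat_add' (k := N)
    (f := fun k : ℕ => ((k + J : ℕ) : ℂ) ^ m * L0 (q.1 + ((k + J : ℕ) : ℂ) * q.2))
    (summable_L0_tail h1 h2)
  rw [W, ← this]
  simp only [add_assoc, W]

lemma HasThirdJet.sum {g a b c d : ℕ → ℂ × ℂ → ℂ} {p : ℂ × ℂ} (N : ℕ)
    (h : ∀ k, HasThirdJet (g k) (a k) (b k) (c k) (d k) p) :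
    HasThirdJet (fun q => ∑ k ∈ Finset.range N, g k q) (fun q => ∑ k ∈ Finset.range N, a k q)
      (fun q => ∑ k ∈ Finset.range N, b k q) (fun q => ∑ k ∈ Finset.range N, c k q)
      (fun q => ∑ k ∈ Finset.range N, d k q) p := by
  induction N with
  | zero =>
    simp only [Finset.range_zero, Finset.sum_empty]
    exact (hasThirdJet_quadratic 0 0 0 0 0 0 0 p).congr_left
      (Eventually.of_forall fun q => by simp [quadratic])
  | succ N ih =>
    simp only [Finset.sum_range_succ]
    exact ih.add (h N)

lemma exists_im_pos (z : ℂ) {τ : ℂ} (hτ : 0 < τ.im) : ∃ N : ℕ, 0 < (z + N * τ).im := by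
  obtain ⟨N, hN⟩ := exists_nat_gt (-z.im / τ.im)
  refine ⟨N, ?_⟩
  rw [div_lt_iff₀ hτ] at hN
  simp
  linarith

/-- From some index on, the arguments lie in the upper half-plane, where the `psi 3` sum is a
primitive. The finitely many earlier terms are integrated three times on small discs avoiding `ℤ`.
-/
lemma exists_hasThirdJet_W_L0 {J : ℕ} {p : ℂ × ℂ} (hτ : 0 < p.2.im)
    (h : ∀ k : ℕ, ∀ n : ℤ, p.1 + ((k + J : ℕ) : ℂ) * p.2 ≠ n) :
    ∃ H, HasThirdJet H (W L0 J 0) (W L0 J 1) (W L0 J 2) (W L0 J 3) p := by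
  obtain ⟨N, hN⟩ := exists_im_pos p.1 hτ
  have hNJ : 0 < (p.1 + (N + J : ℕ) * p.2).im := by
    simp at hN ⊢
    have : 0 ≤ (J : ℝ) * p.2.im := by positivity
    linarith
  choose φ φ1 φ2 hφ using fun k => exists_primitive_L0 (h k)
  have hs := (HasThirdJet.sum N fun k => hasThirdJet_comp_linear _ (hφ k)).add
    (hasThirdJet_W_psi (N + J) hτ hNJ)
  have e1 : ∀ᶠ q : ℂ × ℂ in 𝓝 p, 0 < q.2.im :=
    (isOpen_lt continuous_const (by fun_prop)).mem_nhds hτ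
  have e2 : ∀ᶠ q : ℂ × ℂ in 𝓝 p, 0 < (q.1 + (N + J : ℕ) * q.2).im :=
    (isOpen_lt continuous_const (by fun_prop)).mem_nhds hNJ
  refine ⟨_, hs.congr .rfl ?_ ?_ ?_ ?_⟩
  all_goals
    filter_upwards [e1, e2] with q h1 h2
    simp only [W_L0_split h1 h2, pow_zero, one_mul, pow_one]

lemma regularSet.ne_int {p : ℂ × ℂ} (hp : p ∈ regularSet) (m n : ℤ) : p.1 + m * p.2 ≠ n := by
  intro h
  refine hp.2 n (-m) ?_
  push_cast
  linear_combination h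

lemma regularSet.neg_ne_int {p : ℂ × ℂ} (hp : p ∈ regularSet) (m n : ℤ) :
    -p.1 + m * p.2 ≠ n := by
  intro h
  refine hp.2 (-n) m ?_
  push_cast
  linear_combination -h

/-- A local primitive exists near every regular point. -/
lemma exists_hasThirdJet {p : ℂ × ℂ} (hp : p ∈ regularSet) :
    ∃ H, HasThirdJet H fA fB fC fD p := by
  obtain ⟨H₀, h₀⟩ := exists_hasThirdJet_W_L0 (J := 0) hp.1 fun k n => by
    exact_mod_cast regularSet.ne_int hp ((k + 0 : ℕ) : ℤ) n
  obtain ⟨H₁, h₁⟩ := exists_hasThirdJet_W_L0 (J := 1) (p := (-p.1, p.2)) hp.1 fun k n => by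
    exact_mod_cast regularSet.neg_ne_int hp ((k + 1 : ℕ) : ℤ) n
  exact ⟨_, hasThirdJet_assemble hp.1 h₀ h₁⟩

lemma mem_regularSet_iff {p : ℂ × ℂ} :
    p ∈ regularSet ↔ 0 < p.2.im ∧ ∀ n : ℤ, p.1 + n * p.2 ∈ {u : ℂ | ∀ m : ℤ, u ≠ m} := by
  refine ⟨fun h => ⟨h.1, fun n m => regularSet.ne_int h n m⟩, fun h => ⟨h.1, fun m n h' => ?_⟩⟩
  refine h.2 (-n) m ?_
  push_cast
  linear_combination h'

lemma isOpen_regularSet : IsOpen regularSet := by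
  rw [isOpen_iff_mem_nhds]
  intro p hp
  obtain ⟨N, hN⟩ := exists_im_pos p.1 hp.1
  obtain ⟨M, hM⟩ := exists_im_pos (-p.1) hp.1
  have e0 : ∀ᶠ q : ℂ × ℂ in 𝓝 p, 0 < q.2.im :=
    (isOpen_lt continuous_const (by fun_prop)).mem_nhds hp.1
  have e1 : ∀ᶠ q : ℂ × ℂ in 𝓝 p, 0 < (q.1 + N * q.2).im :=
    (isOpen_lt continuous_const (by fun_prop)).mem_nhds hN
  have e2 : ∀ᶠ q : ℂ × ℂ in 𝓝 p, 0 < (-q.1 + M * q.2).im :=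
    (isOpen_lt continuous_const (by fun_prop)).mem_nhds hM
  -- For `n` outside `[-M, N]` the imaginary part of `z + nτ` is nonzero throughout a neighbourhood
  -- of `p`, so only finitely many open conditions remain.
  have e3 : ∀ᶠ q : ℂ × ℂ in 𝓝 p, ∀ n ∈ Finset.Icc (-(M : ℤ)) N,
      q.1 + n * q.2 ∈ {u : ℂ | ∀ m : ℤ, u ≠ m} := by
    rw [Filter.eventually_all_finset]
    intro n _
    exact (isOpen_ne_int.preimage (f := fun q : ℂ × ℂ => q.1 + n * q.2) (by fun_prop)).mem_nhds
      ((mem_regularSet_iff.1 hp).2 n)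
  filter_upwards [e0, e1, e2, e3] with q h0 h1 h2 h3
  refine mem_regularSet_iff.2 ⟨h0, fun n m hm => ?_⟩
  have him : q.1.im + n * q.2.im = 0 := by simpa using congrArg im hm
  simp only [add_im, mul_im, natCast_re, natCast_im, zero_mul, add_zero, neg_im] at h1 h2
  by_cases hn : n ∈ Finset.Icc (-(M : ℤ)) N
  · exact h3 n hn m hm
  · rw [Finset.mem_Icc, not_and_or, not_le, not_le] at hn
    rcases hn with hn | hn
    · have : (n : ℝ) ≤ -M := by exact_mod_cast hn.le
      nlinarith
    · have : (N : ℝ) ≤ n := by exact_mod_cast hn.le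
      nlinarith

/-! ### Analytic continuation of branches. -/

/-- Every branch of the elliptic trilogarithm has the same third derivatives. -/
lemma IsBranchAt.hasThirdJet {g : ℂ × ℂ → ℂ} {p : ℂ × ℂ} (h : IsBranchAt g p) :
    HasThirdJet g fA fB fC fD p := by
  obtain ⟨γ, G, hγ, hreg, h0, hG0, hdiff, hcont, rfl, hg⟩ := h
  have hloc : IsLocallyConstant fun t => HasThirdJet (G t) fA fB fC fD (γ t) := by
    rw [IsLocallyConstant.iff_eventually_eq]
    intro t
    obtain ⟨H, hH⟩ := exists_hasThirdJet (hreg t)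
    obtain ⟨r, hr, hb⟩ := Metric.eventually_nhds_iff_ball.1 (hH.eventually.and (hdiff t))
    have hball : ∀ᶠ s in 𝓝 t, γ s ∈ Metric.ball (γ t) r :=
      hγ.continuousAt.eventually (Metric.ball_mem_nhds _ hr)
    have hself : γ t ∈ Metric.ball (γ t) r := Metric.mem_ball_self hr
    filter_upwards [hball, hcont t] with s hs hst
    refine propext ⟨fun hjs => ?_, fun hjt => ?_⟩
    -- From time `s` back to `t`: the extension `h` and `G t` agree near `γ s` and are both
    -- holomorphic on the whole ball, so they agree near its centre `γ t`.
    · obtain ⟨h, hh, he⟩ := exists_extension (fun q hq => (hb q hq).1) hs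
        (hjs.congr_left hst.symm)
      have := eqOn_ball_of_eventuallyEq (fun q hq => (hb q hq).2)
        (fun q hq => (hh q hq).differentiableAt) hs he
      exact (hh _ hself).congr_left (eventually_of_mem (Metric.ball_mem_nhds _ hr) this)
    · obtain ⟨h, hh, he⟩ := exists_extension (fun q hq => (hb q hq).1) hself hjt
      have := eqOn_ball_of_eventuallyEq (fun q hq => (hb q hq).2)
        (fun q hq => (hh q hq).differentiableAt) hself he
      exact (hh _ hs).congr_left
        (hst.trans (eventually_of_mem (Metric.isOpen_ball.mem_nhds hs) this))
  have h00 : HasThirdJet (G 0) fA fB fC fD (γ 0) := (hasThirdJet_trilogSeries h0).congr_left hG0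
  have := hloc.apply_eq_of_preconnectedSpace 0 1
  exact HasThirdJet.congr_left (this ▸ h00) hg

lemma isBranchAt_trilogSeries {p : ℂ × ℂ} (hs : p ∈ strip) (hr : p ∈ regularSet) :
    IsBranchAt trilogSeries p :=
  ⟨fun _ => p, fun _ => trilogSeries, continuous_const, fun _ => hr, hs, .rfl,
    fun _ => (hasThirdJet_trilogSeries hs).eventually.mono fun _ h => h.differentiableAt,
    fun _ => Eventually.of_forall fun _ => .rfl, rfl, .rfl⟩

/-- A branch extends along any path in an open set on which it has a holomorphic extension. -/
lemma IsBranchAt.extend {g h : ℂ × ℂ → ℂ} {p p' : ℂ × ℂ} (hg : IsBranchAt g p) (c : Path p p')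
    (hc : ∀ t, c t ∈ regularSet) (hd : ∀ t, ∀ᶠ w in 𝓝 (c t), DifferentiableAt ℂ h w)
    (he : g =ᶠ[𝓝 p] h) : IsBranchAt h p' := by
  obtain ⟨γ, G, hγ, hreg, h0, hG0, hdiff, hcont, h1, hgG⟩ := hg
  have hGh : G 1 =ᶠ[𝓝 p] h := hgG.symm.trans he
  set a : unitInterval → unitInterval := fun t =>
    ⟨min (2 * t) 1, le_min (by have := t.2.1; positivity) zero_le_one, min_le_right _ _⟩ with ha
  set b : unitInterval → unitInterval := fun t =>
    ⟨max (2 * t - 1) 0, le_max_right _ _, max_le (by have := t.2.2; linarith) zero_le_one⟩ with hb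
  have hac : Continuous a := by fun_prop
  have hbc : Continuous b := by fun_prop
  have ha1 : ∀ t : unitInterval, 1 / 2 ≤ (t : ℝ) → a t = 1 := fun t ht =>
    Subtype.ext (min_eq_right (by linarith))
  have hb0 : ∀ t : unitInterval, (t : ℝ) ≤ 1 / 2 → b t = 0 := fun t ht =>
    Subtype.ext (max_eq_right (by linarith))
  set Γ : unitInterval → ℂ × ℂ := fun t => if (t : ℝ) ≤ 1 / 2 then γ (a t) else c (b t) with hΓ
  have hΓ1 : ∀ t : unitInterval, (t : ℝ) ≤ 1 / 2 → Γ t = γ (a t) := fun t ht => if_pos ht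
  have hΓ2 : ∀ t : unitInterval, 1 / 2 ≤ (t : ℝ) → Γ t = c (b t) := fun t ht => by
    rcases ht.eq_or_lt with ht' | ht'
    · rw [hΓ1 t ht'.symm.le, ha1 t ht, hb0 t ht'.symm.le, h1, c.source]
    · exact if_neg (not_le.2 ht')
  have hΓc : Continuous Γ := by
    refine Continuous.if_le (hγ.comp hac) (c.continuous.comp hbc) continuous_subtype_val
      continuous_const fun t ht => ?_
    rw [ha1 t ht.ge, hb0 t ht.le, h1, c.source]
  -- From `t = 1/2` on the element is constantly `h`. At the joint both formulas for `Γ` give `p`,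
  -- where `G 1` and `h` have the same germ.
  refine ⟨Γ, fun t => if (t : ℝ) < 1 / 2 then G (a t) else h, hΓc, fun t => ?_, ?_, ?_,
    fun t => ?_, fun t => ?_, ?_, ?_⟩
  · rcases le_total (t : ℝ) (1 / 2) with ht | ht
    · rw [hΓ1 t ht]; exact hreg _
    · rw [hΓ2 t ht]; exact hc _
  · have : a 0 = 0 := Subtype.ext (by simp [ha])
    rw [hΓ1 0 (by norm_num), this]; exact h0
  · have : a 0 = 0 := Subtype.ext (by simp [ha])
    simp only [hΓ1 0 (by norm_num), this]
    simpa using hG0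
  · rcases lt_or_ge (t : ℝ) (1 / 2) with ht | ht
    · simp only [hΓ1 t ht.le, if_pos ht]; exact hdiff _
    · simp only [hΓ2 t ht, if_neg (not_lt.2 ht)]; exact hd _
  · rcases lt_trichotomy (t : ℝ) (1 / 2) with ht | ht | ht
    · have e : ∀ᶠ s : unitInterval in 𝓝 t, (s : ℝ) < 1 / 2 :=
        continuous_subtype_val.continuousAt.eventually (Iio_mem_nhds ht)
      filter_upwards [e, hac.continuousAt.eventually (hcont (a t))] with s hs hst
      simp only [hΓ1 s hs.le, if_pos hs, if_pos ht]
      exact hst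
    · have hp : Γ t = p := by rw [hΓ1 t ht.le, ha1 t ht.ge, h1]
      have e1 : ∀ᶠ s in 𝓝 t, G 1 =ᶠ[𝓝 (Γ s)] h :=
        hΓc.continuousAt.eventually (by rw [hp]; exact hGh.eventuallyEq_nhds)
      have e2 : ∀ᶠ s in 𝓝 t, G (a s) =ᶠ[𝓝 (γ (a s))] G (a t) :=
        hac.continuousAt.eventually (hcont (a t))
      filter_upwards [e1, e2] with s h1 h2
      rw [if_neg ht.not_lt]
      split_ifs with hs
      · rw [hΓ1 s hs.le] at h1 ⊢
        rw [ha1 t ht.ge] at h2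
        exact h2.trans h1
      · exact .rfl
    · have e : ∀ᶠ s : unitInterval in 𝓝 t, 1 / 2 < (s : ℝ) :=
        continuous_subtype_val.continuousAt.eventually (Ioi_mem_nhds ht)
      filter_upwards [e] with s hs
      rw [if_neg hs.not_gt, if_neg ht.not_gt]
  · have : b 1 = 1 := Subtype.ext (by simp [hb]; norm_num)
    rw [hΓ2 1 (by norm_num), this, c.target]
  · have : ¬ ((1 : unitInterval) : ℝ) < 1 / 2 := by norm_num
    simp only [if_neg this]
    exact .rfl

/-- Continuation inside a small ball. -/
lemma exists_isBranchAt_of_mem_ball {H : ℂ × ℂ → ℂ} {p p' p'' : ℂ × ℂ} {r : ℝ}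
    (hH : ∀ q ∈ Metric.ball p r, HasThirdJet H fA fB fC fD q ∧ q ∈ regularSet)
    (hp' : p' ∈ Metric.ball p r) (hp'' : p'' ∈ Metric.ball p r)
    (h : ∃ g, IsBranchAt g p') : ∃ g, IsBranchAt g p'' := by
  obtain ⟨g, hg⟩ := h
  obtain ⟨h, hh, he⟩ := exists_extension (fun q hq => (hH q hq).1) hp' hg.hasThirdJet
  obtain ⟨c, hc⟩ := ((convex_ball p r).isPathConnected ⟨p', hp'⟩).joinedIn p' hp' p'' hp''
  refine ⟨h, hg.extend c (fun t => (hH _ (hc t)).2) (fun t => ?_) he⟩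
  filter_upwards [Metric.isOpen_ball.mem_nhds (hc t)] with q hq
  exact (hh q hq).differentiableAt

lemma exists_isBranchAt_iff {p : ℂ × ℂ} (hp : p ∈ regularSet) :
    ∀ᶠ q in 𝓝 p, (∃ g, IsBranchAt g q) ↔ ∃ g, IsBranchAt g p := by
  obtain ⟨H, hH⟩ := exists_hasThirdJet hp
  obtain ⟨r, hr, hb⟩ := Metric.eventually_nhds_iff_ball.1
    (hH.eventually.and (isOpen_regularSet.mem_nhds hp))
  filter_upwards [Metric.ball_mem_nhds p hr] with q hq
  exact ⟨exists_isBranchAt_of_mem_ball hb hq (Metric.mem_ball_self hr),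
    exists_isBranchAt_of_mem_ball hb (Metric.mem_ball_self hr) hq⟩

/-- The set removed is countable, and the complement of a countable set in a real vector space of
dimension greater than one is connected. -/
lemma isPreconnected_slice (τ : ℂ) : IsPreconnected {z : ℂ | ∀ m n : ℤ, z ≠ m + n * τ} := by
  have hc : (range fun mn : ℤ × ℤ => (mn.1 : ℂ) + mn.2 * τ).Countable := countable_range _
  have := (hc.isConnected_compl_of_one_lt_rank (by simp [Complex.rank_real_complex])).isPreconnected
  convert this using 1
  ext z
  simp [eq_comm]

/-- The elliptic trilogarithm continues to every regular point. -/
lemma exists_isBranchAt {p : ℂ × ℂ} (hp : p ∈ regularSet) : ∃ g, IsBranchAt g p := by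
  obtain ⟨z, τ⟩ := p
  have hτ : 0 < τ.im := hp.1
  set s : Set ℂ := {z : ℂ | ∀ m n : ℤ, z ≠ m + n * τ} with hs
  have : PreconnectedSpace s := isPreconnected_iff_preconnectedSpace.1 (isPreconnected_slice τ)
  have hloc : IsLocallyConstant fun z : s => ∃ g, IsBranchAt g ((z : ℂ), τ) := by
    rw [IsLocallyConstant.iff_eventually_eq]
    intro z
    have ht : Tendsto (fun w : s => ((w : ℂ), τ)) (𝓝 z) (𝓝 ((z : ℂ), τ)) :=
      Continuous.tendsto (by fun_prop) z
    filter_upwards [ht.eventually (exists_isBranchAt_iff (p := ((z : ℂ), τ)) ⟨hτ, z.2⟩)] with w hw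
    exact propext hw
  -- The base point of the continuation: `τ / 2` is in the strip and off the lattice.
  have hst : (τ / 2, τ) ∈ strip := by
    refine ⟨?_, ?_⟩
    · simpa using hτ
    · have : (τ / 2).im = τ.im / 2 := by simp
      simp only [this]; linarith
  have hmem : τ / 2 ∈ s := by
    intro m n h
    have h2 : τ.im / 2 = n * τ.im := by simpa using congrArg im h
    have h3 : (2 * n : ℝ) = 1 := by
      have := hτ.ne'
      field_simp at h2
      linarith
    have h4 : 2 * n = 1 := by exact_mod_cast h3
    omega
  have := hloc.apply_eq_of_preconnectedSpace ⟨τ / 2, hmem⟩ ⟨z, hp.2⟩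
  have h0 : ∃ g, IsBranchAt g (τ / 2, τ) := ⟨_, isBranchAt_trilogSeries hst ⟨hτ, hmem⟩⟩
  exact this ▸ h0

/-! ### Parity and translation laws for fixed `τ`. -/

/-- `f^{(0,3)} + E_4 / 120`. -/
def fE (q : ℂ × ℂ) : ℂ := W L0 0 3 q + W L0 1 3 (-q.1, q.2) + 1 / 120

section FixedTau

variable {τ : ℂ}

/-- No regularity of `z` is needed: only the tail matters, and `L0` takes the default value `0` at
integers. -/
lemma summable_W_L0 (hτ : 0 < τ.im) (J m : ℕ) (z : ℂ) :
    Summable fun k : ℕ => ((k + J : ℕ) : ℂ) ^ m * L0 (z + ((k + J : ℕ) : ℂ) * τ) := by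
  obtain ⟨N, hN⟩ := exists_im_pos z hτ
  have hNJ : 0 < (z + (N + J : ℕ) * τ).im := by
    simp at hN ⊢
    have : 0 ≤ (J : ℝ) * τ.im := by positivity
    linarith
  exact (summable_nat_add_iff
    (f := fun k : ℕ => ((k + J : ℕ) : ℂ) ^ m * L0 (z + ((k + J : ℕ) : ℂ) * τ)) N).1
    (summable_L0_tail (q := (z, τ)) hτ hNJ)

lemma hasSum_W_L0 (hτ : 0 < τ.im) (J m : ℕ) (z : ℂ) :
    HasSum (fun k : ℕ => ((k + J : ℕ) : ℂ) ^ m * L0 (z + ((k + J : ℕ) : ℂ) * τ))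
      (W L0 J m (z, τ)) :=
  (summable_W_L0 hτ J m z).hasSum

/-- The term `k = 0` survives only for `m = 0`. This is why `fA` alone is singular at the origin. -/
lemma W_L0_zero (hτ : 0 < τ.im) (m : ℕ) (z : ℂ) :
    W L0 0 m (z, τ) = 0 ^ m * L0 z + W L0 1 m (z, τ) := by
  rw [W, (summable_W_L0 hτ 0 m z).tsum_eq_zero_add]
  simp [W]

lemma W_L0_add_one (J m : ℕ) (z : ℂ) : W L0 J m (z + 1, τ) = W L0 J m (z, τ) := by
  refine tsum_congr fun k => ?_
  congr 1
  have := L0_add_int (z + ((k + J : ℕ) : ℂ) * τ) 1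
  rw [← this]
  congr 1
  push_cast
  ring

lemma W_L0_sub_one (J m : ℕ) (z : ℂ) : W L0 J m (z - 1, τ) = W L0 J m (z, τ) := by
  rw [← W_L0_add_one, sub_add_cancel]

/-- The shift by `τ` turns the index `k` into `k + 1`; the coefficients come from expanding `((k +
1) - 1)^m`. -/
lemma W_L0_zero_add_tau (hτ : 0 < τ.im) (z : ℂ) :
    W L0 0 0 (z + τ, τ) = W L0 1 0 (z, τ) ∧
    W L0 0 1 (z + τ, τ) = W L0 1 1 (z, τ) - W L0 1 0 (z, τ) ∧
    W L0 0 2 (z + τ, τ) = W L0 1 2 (z, τ) - 2 * W L0 1 1 (z, τ) + W L0 1 0 (z, τ) ∧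
    W L0 0 3 (z + τ, τ) = W L0 1 3 (z, τ) - 3 * W L0 1 2 (z, τ) + 3 * W L0 1 1 (z, τ)
      - W L0 1 0 (z, τ) := by
  have h0 := hasSum_W_L0 hτ 1 0 z
  have h1 := hasSum_W_L0 hτ 1 1 z
  have h2 := hasSum_W_L0 hτ 1 2 z
  have h3 := hasSum_W_L0 hτ 1 3 z
  have e : ∀ k : ℕ, z + τ + ((k + 0 : ℕ) : ℂ) * τ = z + ((k + 1 : ℕ) : ℂ) * τ := fun k => by
    push_cast; ring
  refine ⟨(tsum_congr fun k => ?_).trans h0.tsum_eq,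
    (tsum_congr fun k => ?_).trans (h1.sub h0).tsum_eq,
    (tsum_congr fun k => ?_).trans ((h2.sub (h1.mul_left 2)).add h0).tsum_eq,
    (tsum_congr fun k => ?_).trans
      (((h3.sub (h2.mul_left 3)).add (h1.mul_left 3)).sub h0).tsum_eq⟩
  all_goals
    simp only [e]
    push_cast
    ring

lemma W_L0_one_sub_tau (hτ : 0 < τ.im) (z : ℂ) :
    W L0 1 0 (z - τ, τ) = W L0 0 0 (z, τ) ∧
    W L0 1 1 (z - τ, τ) = W L0 0 1 (z, τ) + W L0 0 0 (z, τ) ∧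
    W L0 1 2 (z - τ, τ) = W L0 0 2 (z, τ) + 2 * W L0 0 1 (z, τ) + W L0 0 0 (z, τ) ∧
    W L0 1 3 (z - τ, τ) = W L0 0 3 (z, τ) + 3 * W L0 0 2 (z, τ) + 3 * W L0 0 1 (z, τ)
      + W L0 0 0 (z, τ) := by
  have h0 := hasSum_W_L0 hτ 0 0 z
  have h1 := hasSum_W_L0 hτ 0 1 z
  have h2 := hasSum_W_L0 hτ 0 2 z
  have h3 := hasSum_W_L0 hτ 0 3 z
  have e : ∀ k : ℕ, z - τ + ((k + 1 : ℕ) : ℂ) * τ = z + ((k + 0 : ℕ) : ℂ) * τ := fun k => by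
    push_cast; ring
  refine ⟨(tsum_congr fun k => ?_).trans h0.tsum_eq,
    (tsum_congr fun k => ?_).trans (h1.add h0).tsum_eq,
    (tsum_congr fun k => ?_).trans ((h2.add (h1.mul_left 2)).add h0).tsum_eq,
    (tsum_congr fun k => ?_).trans
      (((h3.add (h2.mul_left 3)).add (h1.mul_left 3)).add h0).tsum_eq⟩
  all_goals
    simp only [e]
    push_cast
    ring

lemma L0_add_L0_neg_of_regular {z : ℂ} (h : (z, τ) ∈ regularSet) : L0 z + L0 (-z) = -1 :=
  L0_add_L0_neg fun n hn => h.2 n 0 (by simp [hn])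

lemma fA_neg {z : ℂ} (h : (z, τ) ∈ regularSet) : fA (-z, τ) = -fA (z, τ) := by
  have := L0_add_L0_neg_of_regular h
  simp only [fA, W_L0_zero h.1, neg_neg]
  linear_combination this

lemma fB_neg (hτ : 0 < τ.im) (z : ℂ) : fB (-z, τ) = fB (z, τ) := by
  simp only [fB, W_L0_zero hτ, neg_neg]; ring

lemma fC_neg (hτ : 0 < τ.im) (z : ℂ) : fC (-z, τ) = -fC (z, τ) := by
  simp only [fC, W_L0_zero hτ, neg_neg]; ring

lemma fE_neg (hτ : 0 < τ.im) (z : ℂ) : fE (-z, τ) = fE (z, τ) := by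
  simp only [fE, W_L0_zero hτ, neg_neg]; ring

lemma fA_add_one (z : ℂ) : fA (z + 1, τ) = fA (z, τ) := by
  simp only [fA, W_L0_add_one, neg_add, ← sub_eq_add_neg, W_L0_sub_one]

lemma fB_add_one (z : ℂ) : fB (z + 1, τ) = fB (z, τ) := by
  simp only [fB, W_L0_add_one, neg_add, ← sub_eq_add_neg, W_L0_sub_one]

lemma fC_add_one (z : ℂ) : fC (z + 1, τ) = fC (z, τ) := by
  simp only [fC, W_L0_add_one, neg_add, ← sub_eq_add_neg, W_L0_sub_one]

lemma fE_add_one (z : ℂ) : fE (z + 1, τ) = fE (z, τ) := by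
  simp only [fE, W_L0_add_one, neg_add, ← sub_eq_add_neg, W_L0_sub_one]

/-- Here and in the three laws below, the shift moves the boundary term `L0 (± z)` from one half-sum
to the other. Inversion turns the discrepancy into a constant, which combines with the constants in
the definitions. -/
lemma fA_add_tau {z : ℂ} (h : (z, τ) ∈ regularSet) : fA (z + τ, τ) = fA (z, τ) + 1 := by
  obtain ⟨a0, -, -, -⟩ := W_L0_zero_add_tau h.1 z
  obtain ⟨b0, -, -, -⟩ := W_L0_one_sub_tau h.1 (-z)
  have := L0_add_L0_neg_of_regular h
  have e : -(z + τ) = -z - τ := by ring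
  simp only [fA, e, a0, b0, W_L0_zero h.1]
  linear_combination -this

lemma fB_add_tau {z : ℂ} (h : (z, τ) ∈ regularSet) :
    fB (z + τ, τ) = fB (z, τ) - fA (z, τ) - 1 / 2 := by
  obtain ⟨-, a1, -, -⟩ := W_L0_zero_add_tau h.1 z
  obtain ⟨-, b1, -, -⟩ := W_L0_one_sub_tau h.1 (-z)
  have := L0_add_L0_neg_of_regular h
  have e : -(z + τ) = -z - τ := by ring
  simp only [fB, fA, e, a1, b1, W_L0_zero h.1]
  linear_combination this

lemma fC_add_tau {z : ℂ} (h : (z, τ) ∈ regularSet) :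
    fC (z + τ, τ) = fC (z, τ) - 2 * fB (z, τ) + fA (z, τ) + 1 / 3 := by
  obtain ⟨-, -, a2, -⟩ := W_L0_zero_add_tau h.1 z
  obtain ⟨-, -, b2, -⟩ := W_L0_one_sub_tau h.1 (-z)
  have := L0_add_L0_neg_of_regular h
  have e : -(z + τ) = -z - τ := by ring
  simp only [fC, fB, fA, e, a2, b2, W_L0_zero h.1]
  linear_combination -this

lemma fE_add_tau {z : ℂ} (h : (z, τ) ∈ regularSet) :
    fE (z + τ, τ) = fE (z, τ) - 3 * fC (z, τ) + 3 * fB (z, τ) - fA (z, τ) - 1 / 4 := by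
  obtain ⟨-, -, -, a3⟩ := W_L0_zero_add_tau h.1 z
  obtain ⟨-, -, -, b3⟩ := W_L0_one_sub_tau h.1 (-z)
  have := L0_add_L0_neg_of_regular h
  have e : -(z + τ) = -z - τ := by ring
  simp only [fE, fC, fB, fA, e, a3, b3, W_L0_zero h.1]
  linear_combination this

/-! ### Differentiability in `z` -/

lemma differentiableAt_W_L0 (hτ : 0 < τ.im) {J : ℕ} (m : ℕ) {z : ℂ}
    (h : ∀ k : ℕ, ∀ n : ℤ, z + ((k + J : ℕ) : ℂ) * τ ≠ n) :
    DifferentiableAt ℂ (fun w => W L0 J m (w, τ)) z := by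
  obtain ⟨N, hN⟩ := exists_im_pos z hτ
  have hNJ : 0 < (z + (N + J : ℕ) * τ).im := by
    simp at hN ⊢
    have : 0 ≤ (J : ℝ) * τ.im := by positivity
    linarith
  have e2 : ∀ᶠ w : ℂ in 𝓝 z, 0 < (w + (N + J : ℕ) * τ).im :=
    (isOpen_lt continuous_const (by fun_prop)).mem_nhds hNJ
  have heq : (fun w => W L0 J m (w, τ)) =ᶠ[𝓝 z] fun w => ∑ k ∈ Finset.range N,
      ((k + J : ℕ) : ℂ) ^ m * L0 (w + ((k + J : ℕ) : ℂ) * τ) + W L0 (N + J) m (w, τ) := by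
    filter_upwards [e2] with w hw
    exact W_L0_split (q := (w, τ)) hτ hw
  refine DifferentiableAt.congr_of_eventuallyEq ?_ heq
  refine (DifferentiableAt.fun_sum fun k _ => ?_).fun_add ?_
  · have : DifferentiableAt ℂ (fun w : ℂ => w + ((k + J : ℕ) : ℂ) * τ) z := by fun_prop
    exact (DifferentiableAt.fun_comp' z (L0_differentiableAt (h k)) this).const_mul _
  · exact (hasDerivAt_fst_of_lin (q := (z, τ)) (hasFDerivAt_W
      (fun u hu => hasDerivAt_L0 fun n => ne_int_of_im_pos hu n)
      expDecay_L0 expDecay_L0' (N + J) m (p := (z, τ)) hτ hNJ)).differentiableAt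

lemma differentiableAt_W_one {z : ℂ} (hτ : 0 < τ.im) (h : z = 0 ∨ (z, τ) ∈ regularSet) (m : ℕ) :
    DifferentiableAt ℂ (fun w => W L0 1 m (w, τ)) z := by
  refine differentiableAt_W_L0 hτ m fun k n hn => ?_
  rcases h with rfl | h
  · have h1 : ((k + 1 : ℕ) : ℝ) * τ.im = 0 := by simpa using congrArg im hn
    have : 0 < ((k + 1 : ℕ) : ℝ) * τ.im := by positivity
    linarith
  · exact regularSet.ne_int h ((k + 1 : ℕ) : ℤ) n (by exact_mod_cast hn)

lemma regularSet_neg {z : ℂ} (h : (z, τ) ∈ regularSet) : (-z, τ) ∈ regularSet :=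
  ⟨h.1, fun m n hm => h.2 (-m) (-n) (by push_cast; linear_combination -hm)⟩

lemma differentiableAt_W_one_neg {z : ℂ} (hτ : 0 < τ.im) (h : z = 0 ∨ (z, τ) ∈ regularSet)
    (m : ℕ) : DifferentiableAt ℂ (fun w => W L0 1 m (-w, τ)) z := by
  have h' : -z = 0 ∨ (-z, τ) ∈ regularSet := h.imp (by simp) regularSet_neg
  exact DifferentiableAt.fun_comp' (g := fun w => W L0 1 m (w, τ)) (f := fun w : ℂ => -w) z
    (differentiableAt_W_one hτ h' m) differentiableAt_id.fun_neg

lemma differentiableAt_fB {z : ℂ} (hτ : 0 < τ.im) (h : z = 0 ∨ (z, τ) ∈ regularSet) :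
    DifferentiableAt ℂ (fun w => fB (w, τ)) z := by
  simp only [fB, W_L0_zero hτ, ne_eq, one_ne_zero, not_false_eq_true, zero_pow, zero_mul, zero_add]
  exact ((differentiableAt_W_one hτ h 1).fun_add (differentiableAt_W_one_neg hτ h 1)).sub_const _

lemma differentiableAt_fC {z : ℂ} (hτ : 0 < τ.im) (h : z = 0 ∨ (z, τ) ∈ regularSet) :
    DifferentiableAt ℂ (fun w => fC (w, τ)) z := by
  simp only [fC, W_L0_zero hτ, ne_eq, OfNat.ofNat_ne_zero, not_false_eq_true, zero_pow, zero_mul,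
    zero_add]
  exact (differentiableAt_W_one hτ h 2).fun_sub (differentiableAt_W_one_neg hτ h 2)

lemma differentiableAt_fE {z : ℂ} (hτ : 0 < τ.im) (h : z = 0 ∨ (z, τ) ∈ regularSet) :
    DifferentiableAt ℂ (fun w => fE (w, τ)) z := by
  simp only [fE, W_L0_zero hτ, ne_eq, OfNat.ofNat_ne_zero, not_false_eq_true, zero_pow, zero_mul,
    zero_add]
  exact ((differentiableAt_W_one hτ h 3).fun_add (differentiableAt_W_one_neg hτ h 3)).add_const _

lemma differentiableAt_fA {z : ℂ} (h : (z, τ) ∈ regularSet) :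
    DifferentiableAt ℂ (fun w => fA (w, τ)) z := by
  simp only [fA, W_L0_zero h.1, pow_zero, one_mul]
  exact (((L0_differentiableAt fun n hn => h.2 n 0 (by simp [hn])).fun_add
    (differentiableAt_W_one h.1 (.inr h) 0)).fun_sub
    (differentiableAt_W_one_neg h.1 (.inr h) 0)).add_const _

lemma isBigO_one_of_continuousAt {g : ℂ → ℂ} (h : ContinuousAt g 0) :
    g =O[𝓝[≠] 0] fun _ => (1 : ℂ) :=
  (h.tendsto.mono_left nhdsWithin_le_nhds).isBigO_one ℂ

/-- `L0 u` is `-e(u) u⁻¹` divided by the difference quotient of `ex` at `0`, which tends to `2πi ≠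
0`. -/
lemma isBigO_L0 : L0 =O[𝓝[≠] 0] fun u : ℂ => u⁻¹ := by
  have h := hasDerivAt_ex 0
  have h0 : ex 0 = 1 := by simp [ex]
  have h1 := (hasDerivAt_iff_tendsto_slope.1 h).inv₀ (mul_ne_zero two_pi_I_ne (ex_ne_zero 0))
  have h2 := ((h.continuousAt.tendsto.mono_left nhdsWithin_le_nhds).mul h1).isBigO_one ℂ
  refine (h2.neg_left.mul (Asymptotics.isBigO_refl (fun u : ℂ => u⁻¹) (𝓝[≠] 0))).congr' ?_ ?_
  · filter_upwards [self_mem_nhdsWithin] with u hu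
    have hu : u ≠ 0 := hu
    rw [slope_def_field, h0, sub_zero, L0, inv_div, ← neg_sub (ex u) 1, div_neg]
    field_simp
  · exact Eventually.of_forall fun u => one_mul _

lemma isBigO_one_inv : (fun _ : ℂ => (1 : ℂ)) =O[𝓝[≠] 0] fun u : ℂ => u⁻¹ := by
  have h : (fun u : ℂ => u) =O[𝓝[≠] 0] fun _ => (1 : ℂ) :=
    isBigO_one_of_continuousAt continuousAt_id
  refine (h.mul (Asymptotics.isBigO_refl (fun u : ℂ => u⁻¹) (𝓝[≠] 0))).congr' ?_ ?_
  · filter_upwards [self_mem_nhdsWithin] with u hu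
    exact mul_inv_cancel₀ hu
  · exact Eventually.of_forall fun u => one_mul _

/-- `fA` has at most a simple pole at the origin. -/
lemma isBigO_fA (hτ : 0 < τ.im) : (fun u => fA (u, τ)) =O[𝓝[≠] 0] fun u : ℂ => u⁻¹ := by
  have hd : DifferentiableAt ℂ (fun u => W L0 1 0 (u, τ) - W L0 1 0 (-u, τ) + 1 / 2) 0 :=
    ((differentiableAt_W_one hτ (.inl rfl) 0).fun_sub
      (differentiableAt_W_one_neg hτ (.inl rfl) 0)).add_const _
  refine (isBigO_L0.add ((isBigO_one_of_continuousAt hd.continuousAt).trans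
    isBigO_one_inv)).congr_left fun u => ?_
  simp only [fA, W_L0_zero hτ, pow_zero, one_mul]
  ring

lemma isBigO_fA_mul (hτ : 0 < τ.im) {g : ℂ → ℂ} (hg : DifferentiableAt ℂ g 0) (h0 : g 0 = 0) :
    (fun u => fA (u, τ) * g u) =O[𝓝[≠] 0] fun _ => (1 : ℂ) := by
  have h1 : g =O[𝓝[≠] 0] fun u : ℂ => u := by
    have := hg.isBigO_sub.mono (nhdsWithin_le_nhds (s := {0}ᶜ))
    simpa [h0] using this
  refine ((isBigO_fA hτ).mul h1).congr' .rfl ?_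
  filter_upwards [self_mem_nhdsWithin] with u hu
  exact inv_mul_cancel₀ hu

end FixedTau

/-! ### Liouville's theorem for elliptic functions with removable singularities -/

section Liouville

variable {τ : ℂ}

lemma regularSet_add_lattice {z : ℂ} (h : (z, τ) ∈ regularSet) (m n : ℤ) :
    (z + (m + n * τ), τ) ∈ regularSet :=
  ⟨h.1, fun m' n' h' => h.2 (m' - m) (n' - n) (by push_cast; linear_combination h')⟩

lemma eventually_regularSet (hτ : 0 < τ.im) (z : ℂ) : ∀ᶠ w in 𝓝[≠] z, (w, τ) ∈ regularSet := by
  by_cases hz : (z, τ) ∈ regularSet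
  · have ht : Tendsto (fun w : ℂ => (w, τ)) (𝓝 z) (𝓝 (z, τ)) :=
      Continuous.tendsto (by fun_prop) z
    exact nhdsWithin_le_nhds (ht.eventually (isOpen_regularSet.mem_nhds hz))
  · have hz' : ∃ m n : ℤ, z = m + n * τ := by
      by_contra! h
      exact hz ⟨hτ, h⟩
    obtain ⟨m, n, rfl⟩ := hz'
    -- Within distance `Im τ` the coefficient of `τ` in a difference of lattice points must vanish;
    -- the difference is then an integer of modulus less than `1`, hence `0`.
    have hb : Metric.ball ((m : ℂ) + n * τ) (min 1 τ.im) ∈ 𝓝 ((m : ℂ) + n * τ) :=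
      Metric.ball_mem_nhds _ (lt_min one_pos hτ)
    filter_upwards [nhdsWithin_le_nhds hb, self_mem_nhdsWithin] with w hw hne
    refine ⟨hτ, fun m' n' h => hne ?_⟩
    simp only at h
    rw [Metric.mem_ball, dist_eq_norm, lt_min_iff] at hw
    have hd : w - (m + n * τ) = ((m' - m : ℤ) : ℂ) + ((n' - n : ℤ) : ℂ) * τ := by
      rw [h]; push_cast; ring
    rw [hd] at hw
    have hn : n' - n = 0 := by
      have h1 := (abs_im_le_norm _).trans_lt hw.2
      simp only [add_im, intCast_im, mul_im, intCast_re, zero_mul, add_zero, zero_add, abs_mul,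
        abs_of_pos hτ] at h1
      have h2 : |((n' - n : ℤ) : ℝ)| < 1 := by
        by_contra! h3
        nlinarith
      exact Int.abs_lt_one_iff.1 (by exact_mod_cast h2)
    rw [hn] at hw
    have hm : m' - m = 0 := by
      have h1 := hw.1
      simp only [Int.cast_zero, zero_mul, add_zero, norm_intCast] at h1
      exact Int.abs_lt_one_iff.1 (by exact_mod_cast h1)
    rw [h, sub_eq_zero.1 hn, sub_eq_zero.1 hm]
    rfl

lemma apply_add_lattice {g : ℂ → ℂ} {s : Set ℂ}
    (hs : ∀ z ∈ s, ∀ m n : ℤ, z + (m + n * τ) ∈ s)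
    (h1 : ∀ z ∈ s, g (z + 1) = g z) (h2 : ∀ z ∈ s, g (z + τ) = g z) {z : ℂ} (hz : z ∈ s)
    (m n : ℤ) : g (z + (m + n * τ)) = g z := by
  have key : ∀ v : ℂ, (∀ z ∈ s, ∀ k : ℤ, z + k * v ∈ s) → (∀ z ∈ s, g (z + v) = g z) →
      ∀ z ∈ s, ∀ k : ℤ, g (z + k * v) = g z := by
    intro v hv hg z hz k
    induction k using Int.induction_on with
    | zero => simp
    | succ k ih =>
      rw [← ih, ← hg _ (hv z hz k)]
      congr 1; push_cast; ring
    | pred k ih =>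
      rw [← ih, ← hg _ (hv z hz (-k - 1))]
      congr 1; push_cast; ring
  have hs1 : ∀ z ∈ s, ∀ k : ℤ, z + k * 1 ∈ s := fun z hz k => by simpa using hs z hz k 0
  have hs2 : ∀ z ∈ s, ∀ k : ℤ, z + k * τ ∈ s := fun z hz k => by simpa using hs z hz 0 k
  have := key τ hs2 h2 _ (hs1 z hz m) n
  rw [key 1 hs1 h1 z hz m] at this
  rw [← this]
  congr 1; ring

lemma isCompact_range_of_periods (hτ : 0 < τ.im) {h : ℂ → ℂ} (hc : Continuous h)
    (h1 : ∀ z, h (z + 1) = h z) (h2 : ∀ z, h (z + τ) = h z) :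
    Bornology.IsBounded (range h) := by
  have hK : IsCompact (Icc (0 : ℝ) 1 ×ℂ Icc 0 τ.im) := isCompact_Icc.reProdIm isCompact_Icc
  refine (hK.image hc).isBounded.subset ?_
  rintro _ ⟨z, rfl⟩
  set n := ⌊z.im / τ.im⌋ with hn
  set m := ⌊(z - n * τ).re⌋ with hm
  -- A multiple of `τ` first brings the imaginary part into `[0, Im τ]`, then an integer brings the
  -- real part into `[0, 1]`. The rectangle is not a period parallelogram, but it meets every class.
  refine ⟨z + ((-m : ℤ) + (-n : ℤ) * τ), ?_, apply_add_lattice (s := univ) (fun _ _ _ _ => mem_univ _)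
    (fun z _ => h1 z) (fun z _ => h2 z) (mem_univ z) _ _⟩
  have e : z + ((-m : ℤ) + (-n : ℤ) * τ) = z - n * τ - m := by push_cast; ring
  rw [e, mem_reProdIm]
  refine ⟨?_, ?_⟩
  · have a1 := Int.floor_le (z - n * τ).re
    have a2 := Int.lt_floor_add_one (z - n * τ).re
    rw [← hm] at a1 a2
    simp only [sub_re, intCast_re, mem_Icc] at a1 a2 ⊢
    constructor <;> linarith
  · have a1 := Int.floor_le (z.im / τ.im)
    have a2 := Int.lt_floor_add_one (z.im / τ.im)
    rw [← hn] at a1 a2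
    rw [le_div_iff₀ hτ] at a1
    rw [div_lt_iff₀ hτ] at a2
    simp only [sub_im, intCast_im, mul_im, intCast_re, zero_mul, add_zero, sub_zero, mem_Icc]
    constructor <;> linarith

/-- An elliptic function, holomorphic outside `a + Λ` and `b + Λ` and bounded near `a` and `b`, is
constant. -/
theorem exists_const_of_elliptic (hτ : 0 < τ.im) {g : ℂ → ℂ} {a b : ℂ}
    (hd : ∀ z, (z - a, τ) ∈ regularSet → (z - b, τ) ∈ regularSet → DifferentiableAt ℂ g z)
    (h1 : ∀ z, (z - a, τ) ∈ regularSet → (z - b, τ) ∈ regularSet → g (z + 1) = g z)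
    (h2 : ∀ z, (z - a, τ) ∈ regularSet → (z - b, τ) ∈ regularSet → g (z + τ) = g z)
    (ha : (fun u => g (a + u)) =O[𝓝[≠] 0] fun _ => (1 : ℂ))
    (hb : (fun u => g (b + u)) =O[𝓝[≠] 0] fun _ => (1 : ℂ)) :
    ∃ c, ∀ z, (z - a, τ) ∈ regularSet → (z - b, τ) ∈ regularSet → g z = c := by
  set s : Set ℂ := {z | (z - a, τ) ∈ regularSet ∧ (z - b, τ) ∈ regularSet} with hs
  have hsΛ : ∀ z ∈ s, ∀ m n : ℤ, z + (m + n * τ) ∈ s := fun z hz m n => by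
    have e : ∀ w : ℂ, z + (m + n * τ) - w = z - w + (m + n * τ) := fun w => by ring
    refine ⟨?_, ?_⟩
    · simpa only [e] using regularSet_add_lattice hz.1 m n
    · simpa only [e] using regularSet_add_lattice hz.2 m n
  have hper : ∀ z ∈ s, ∀ m n : ℤ, g (z + (m + n * τ)) = g z := fun z hz m n =>
    apply_add_lattice hsΛ (fun z hz => h1 z hz.1 hz.2) (fun z hz => h2 z hz.1 hz.2) hz m n
  have hso : IsOpen s :=
    (isOpen_regularSet.preimage (f := fun z => (z - a, τ)) (by fun_prop)).inter
      (isOpen_regularSet.preimage (f := fun z => (z - b, τ)) (by fun_prop))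
  have htr : ∀ w z : ℂ, Tendsto (fun u => u - w) (𝓝[≠] z) (𝓝[≠] (z - w)) := fun w z => by
    refine tendsto_nhdsWithin_iff.2 ⟨(Continuous.tendsto (by fun_prop) z).mono_left
      nhdsWithin_le_nhds, ?_⟩
    filter_upwards [self_mem_nhdsWithin] with u hu
    simpa [sub_eq_zero, sub_left_inj] using hu
  have hpunc : ∀ z, ∀ᶠ w in 𝓝[≠] z, w ∈ s := fun z =>
    ((htr a z).eventually (eventually_regularSet hτ _)).and
      ((htr b z).eventually (eventually_regularSet hτ _))
  have hbd1 : ∀ w : ℂ, (fun u => g (w + u)) =O[𝓝[≠] 0] (fun _ => (1 : ℂ)) →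
      ∀ m n : ℤ, g =O[𝓝[≠] (w + (m + n * τ))] fun _ => (1 : ℂ) := by
    intro w hw m n
    have ht := htr (w + (m + n * τ)) (w + (m + n * τ))
    rw [sub_self] at ht
    refine (hw.comp_tendsto ht).congr' ?_ .rfl
    filter_upwards [hpunc (w + (m + n * τ))] with u hu
    have := hper u hu (-m) (-n)
    rw [← this]
    simp only [Function.comp]
    congr 1
    push_cast
    ring
  have hbd : ∀ z, g =O[𝓝[≠] z] fun _ => (1 : ℂ) := by
    intro z
    by_cases hz : z ∈ s
    · exact ((hd z hz.1 hz.2).continuousAt.tendsto.mono_left nhdsWithin_le_nhds).isBigO_one ℂ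
    · have hz' : (∃ m n : ℤ, z - a = m + n * τ) ∨ ∃ m n : ℤ, z - b = m + n * τ := by
        by_contra! h
        exact hz ⟨⟨hτ, h.1⟩, ⟨hτ, h.2⟩⟩
      rcases hz' with ⟨m, n, h⟩ | ⟨m, n, h⟩
      · rw [eq_add_of_sub_eq' h]; exact hbd1 a ha m n
      · rw [eq_add_of_sub_eq' h]; exact hbd1 b hb m n
  -- Taking punctured limits everywhere fills in all the removable singularities at once; `h` turns
  -- out entire, periodic and bounded.
  set h : ℂ → ℂ := fun z => limUnder (𝓝[≠] z) g with hh
  have hlim : ∀ z, Tendsto g (𝓝[≠] z) (𝓝 (h z)) := by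
    intro z
    refine tendsto_limUnder_of_differentiable_on_punctured_nhds_of_bounded_under
      ((hpunc z).mono fun w hw => hd w hw.1 hw.2) ?_
    have hsub := (hbd z).sub (Asymptotics.isBigO_const_const (g z) (one_ne_zero (α := ℂ)) _)
    exact (Asymptotics.isBigO_one_iff ℂ).1 hsub
  have hg : ∀ z ∈ s, h z = g z := fun z hz => tendsto_nhds_unique (hlim z)
    ((hd z hz.1 hz.2).continuousAt.tendsto.mono_left nhdsWithin_le_nhds)
  have hcont : Continuous h := by
    refine continuous_iff_continuousAt.2 fun z => continuousAt_iff_punctured_nhds.2 ?_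
    refine (hlim z).congr' ?_
    filter_upwards [hpunc z] with w hw using (hg w hw).symm
  have hdiff : Differentiable ℂ h := fun z => by
    refine (analyticAt_of_differentiable_on_punctured_nhds_of_continuousAt ?_
      hcont.continuousAt).differentiableAt
    filter_upwards [hpunc z] with w hw
    exact (hd w hw.1 hw.2).congr_of_eventuallyEq (eventually_of_mem (hso.mem_nhds hw) hg)
  have hdense : Dense s := fun z =>
    mem_closure_of_tendsto (f := id) (b := 𝓝[≠] z) (tendsto_id'.2 nhdsWithin_le_nhds) (hpunc z)
  have hp : ∀ m n : ℤ, ∀ z, h (z + (m + n * τ)) = h z := fun m n => congrFun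
    (Continuous.ext_on hdense (hcont.comp (continuous_id.add continuous_const)) hcont fun z hz => by
      rw [hg z hz, hg _ (hsΛ z hz m n), hper z hz])
  have hbdd := isCompact_range_of_periods hτ hcont (fun z => by simpa using hp 1 0 z)
    (fun z => by simpa using hp 0 1 z)
  exact ⟨h 0, fun z hza hzb => (hg z ⟨hza, hzb⟩).symm.trans
    (hdiff.apply_eq_apply_of_bounded hbdd z 0)⟩

end Liouville

/-! ### The three-point relations are constant in each variable. -/

section Identities

variable {τ : ℂ}

/-- The combination of weight two attached to `x + y = s`. -/
def relV (τ x y : ℂ) : ℂ :=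
  fA (x + y, τ) * (fA (x, τ) + fA (y, τ)) - fA (x, τ) * fA (y, τ)
    + fB (x, τ) + fB (x + y, τ) + fB (y, τ)

/-- The combination of weight three attached to `x + y = s`. -/
def relT (τ x y : ℂ) : ℂ :=
  fA (x, τ) * (fB (y, τ) - fB (x + y, τ)) + fA (x + y, τ) * (fB (x, τ) - fB (y, τ))
    + 1 / 2 * fC (x, τ) - 1 / 2 * fC (x + y, τ) - fC (y, τ)

/-- The combination of weight four attached to `x + y = s`. -/
def relU (τ x y : ℂ) : ℂ :=
  fA (x, τ) * (fC (y, τ) - fC (x + y, τ)) - fA (x + y, τ) * (fC (x, τ) + fC (y, τ))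
    + 2 * (fB (x, τ) * fB (x + y, τ)) - 1 / 3 * (fE (x, τ) + fE (x + y, τ) + 3 * fE (y, τ))

/-- The pattern for every removable singularity below: the zero of the cofactor `g` cancels the
simple pole of `fA`. -/
lemma isBigO_pole (hτ : 0 < τ.im) {F g r : ℂ → ℂ} (hF : ∀ u, F u = fA (u, τ) * g u + r u)
    (hg : DifferentiableAt ℂ g 0) (h0 : g 0 = 0) (hr : DifferentiableAt ℂ r 0) :
    F =O[𝓝[≠] 0] fun _ => (1 : ℂ) :=
  ((isBigO_fA_mul hτ hg h0).add (isBigO_one_of_continuousAt hr.continuousAt)).congr_left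
    fun u => (hF u).symm

lemma differentiableAt_add_const {f : ℂ → ℂ} {x y s : ℂ} (hs : x + y = s)
    (h : DifferentiableAt ℂ f s) : DifferentiableAt ℂ (fun w => f (w + y)) x :=
  DifferentiableAt.fun_comp' (g := f) x (by rwa [hs]) (differentiableAt_id.add_const y)

lemma differentiableAt_const_add {f : ℂ → ℂ} {x y s : ℂ} (hs : y + x = s)
    (h : DifferentiableAt ℂ f s) : DifferentiableAt ℂ (fun w => f (y + w)) x :=
  DifferentiableAt.fun_comp' (g := f) x (by rwa [hs]) (differentiableAt_id.const_add y)

/-- Differentiability of a relation-shaped expression. -/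
lemma differentiableAt_relT_shape {f1 f2 f3 f4 f5 f6 f7 : ℂ → ℂ} {x : ℂ}
    (h1 : DifferentiableAt ℂ f1 x) (h2 : DifferentiableAt ℂ f2 x) (h3 : DifferentiableAt ℂ f3 x)
    (h4 : DifferentiableAt ℂ f4 x) (h5 : DifferentiableAt ℂ f5 x) (h6 : DifferentiableAt ℂ f6 x)
    (h7 : DifferentiableAt ℂ f7 x) {f8 : ℂ → ℂ} (h8 : DifferentiableAt ℂ f8 x) :
    DifferentiableAt ℂ (fun w => f1 w * (f2 w - f3 w) + f4 w * (f5 w - f2 w) + 1 / 2 * f6 w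
      - 1 / 2 * f7 w - f8 w) x := by
  fun_prop

lemma differentiableAt_relU_shape {f1 f2 f3 f4 f5 f6 f7 f8 f9 f10 : ℂ → ℂ} {x : ℂ}
    (h1 : DifferentiableAt ℂ f1 x) (h2 : DifferentiableAt ℂ f2 x) (h3 : DifferentiableAt ℂ f3 x)
    (h4 : DifferentiableAt ℂ f4 x) (h5 : DifferentiableAt ℂ f5 x) (h6 : DifferentiableAt ℂ f6 x)
    (h7 : DifferentiableAt ℂ f7 x) (h8 : DifferentiableAt ℂ f8 x) (h9 : DifferentiableAt ℂ f9 x)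
    (h10 : DifferentiableAt ℂ f10 x) :
    DifferentiableAt ℂ (fun w => f1 w * (f2 w - f3 w) - f4 w * (f5 w + f2 w)
      + 2 * (f6 w * f7 w) - 1 / 3 * (f8 w + f9 w + 3 * f10 w)) x := by
  fun_prop

lemma regularSet_of_sub_zero {x : ℂ} (h : (x - 0, τ) ∈ regularSet) : (x, τ) ∈ regularSet := by
  rwa [sub_zero] at h

/-- The pole at `x = 0` has cofactor `fA(x + y) - fA(y)`, and the one at `x = -y` has cofactor
`fA(x) + fA(y)`, zero there because `fA` is odd. -/
lemma exists_relV_const_left {y : ℂ} (hy : (y, τ) ∈ regularSet) :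
    ∃ c, ∀ x, (x, τ) ∈ regularSet → (x + y, τ) ∈ regularSet → relV τ x y = c := by
  have hτ : 0 < τ.im := hy.1
  have hny := regularSet_neg hy
  have dA := differentiableAt_fA hy
  have dB := differentiableAt_fB hτ (.inr hy)
  have dA' := differentiableAt_fA hny
  have dB' := differentiableAt_fB hτ (.inr hny)
  have dB0 := differentiableAt_fB hτ (.inl rfl)
  suffices h : ∃ c, ∀ z, (z - 0, τ) ∈ regularSet → (z - -y, τ) ∈ regularSet →
      (fun x => relV τ x y) z = c by
    obtain ⟨c, hc⟩ := h
    exact ⟨c, fun x hx hs => hc x (by rwa [sub_zero]) (by rwa [sub_neg_eq_add])⟩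
  refine exists_const_of_elliptic hτ ?_ ?_ ?_ ?_ ?_
  · intro x hx hs
    replace hx := regularSet_of_sub_zero hx
    rw [sub_neg_eq_add] at hs
    have h1 := differentiableAt_fA hx
    have h2 := differentiableAt_fB hτ (.inr hx)
    exact ((((differentiableAt_add_const rfl (differentiableAt_fA hs)).fun_mul
      (h1.add_const _)).fun_sub (h1.mul_const _)).fun_add h2 |>.fun_add
      (differentiableAt_add_const rfl (differentiableAt_fB hτ (.inr hs)))).add_const _
  · intro x _ _
    simp only [relV, add_right_comm x 1 y, fA_add_one, fB_add_one]
  · intro x hx hs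
    replace hx := regularSet_of_sub_zero hx
    rw [sub_neg_eq_add] at hs
    simp only [relV, add_right_comm x τ y, fA_add_tau hx, fB_add_tau hx,
      fA_add_tau hs, fB_add_tau hs]
    ring
  · refine isBigO_pole hτ (g := fun u => fA (u + y, τ) - fA (y, τ))
      (r := fun u => fA (u + y, τ) * fA (y, τ) + fB (u, τ) + fB (u + y, τ) + fB (y, τ))
      (fun u => ?_) ?_ (by simp) ?_
    · simp only [relV, zero_add]; ring
    · exact (differentiableAt_add_const (zero_add y) dA).sub_const _
    · exact ((((differentiableAt_add_const (zero_add y) dA).mul_const _).fun_add dB0).fun_add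
        (differentiableAt_add_const (zero_add y) dB)).add_const _
  · refine isBigO_pole hτ (g := fun u => fA (-y + u, τ) + fA (y, τ))
      (r := fun u => -(fA (-y + u, τ) * fA (y, τ)) + fB (-y + u, τ) + fB (u, τ) + fB (y, τ))
      (fun u => ?_) ?_ ?_ ?_
    · have e : -y + u + y = u := by ring
      simp only [relV, e]; ring
    · exact (differentiableAt_const_add (add_zero _) dA').add_const _
    · simp [fA_neg hy]
    · exact ((((differentiableAt_const_add (add_zero _) dA').mul_const _).fun_neg.fun_add
        (differentiableAt_const_add (add_zero _) dB')).fun_add dB0).add_const _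

lemma exists_relV_const_right {x : ℂ} (hx : (x, τ) ∈ regularSet) :
    ∃ c, ∀ y, (y, τ) ∈ regularSet → (x + y, τ) ∈ regularSet → relV τ x y = c := by
  obtain ⟨c, hc⟩ := exists_relV_const_left hx
  refine ⟨c, fun y hy hs => ?_⟩
  rw [add_comm] at hs
  rw [← hc y hy hs, relV, relV, add_comm y x]
  ring

/-- The cofactors are `fB(y) - fB(x + y)` at `x = 0` and `fB(x) - fB(y)` at `x = -y`; the second
vanishes because `fB` is even. -/
lemma exists_relT_const_left {y : ℂ} (hy : (y, τ) ∈ regularSet) :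
    ∃ c, ∀ x, (x, τ) ∈ regularSet → (x + y, τ) ∈ regularSet → relT τ x y = c := by
  have hτ : 0 < τ.im := hy.1
  have hny := regularSet_neg hy
  have dA := differentiableAt_fA hy
  have dB := differentiableAt_fB hτ (.inr hy)
  have dC := differentiableAt_fC hτ (.inr hy)
  have dA' := differentiableAt_fA hny
  have dB' := differentiableAt_fB hτ (.inr hny)
  have dC' := differentiableAt_fC hτ (.inr hny)
  have dB0 := differentiableAt_fB hτ (.inl rfl)
  have dC0 := differentiableAt_fC hτ (.inl rfl)
  suffices h : ∃ c, ∀ z, (z - 0, τ) ∈ regularSet → (z - -y, τ) ∈ regularSet →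
      (fun x => relT τ x y) z = c by
    obtain ⟨c, hc⟩ := h
    exact ⟨c, fun x hx hs => hc x (by rwa [sub_zero]) (by rwa [sub_neg_eq_add])⟩
  refine exists_const_of_elliptic hτ ?_ ?_ ?_ ?_ ?_
  · intro x hx hs
    replace hx := regularSet_of_sub_zero hx
    rw [sub_neg_eq_add] at hs
    exact differentiableAt_relT_shape (differentiableAt_fA hx) (differentiableAt_const _)
      (differentiableAt_add_const rfl (differentiableAt_fB hτ (.inr hs)))
      (differentiableAt_add_const rfl (differentiableAt_fA hs)) (differentiableAt_fB hτ (.inr hx))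
      (differentiableAt_fC hτ (.inr hx))
      (differentiableAt_add_const rfl (differentiableAt_fC hτ (.inr hs))) (differentiableAt_const _)
  · intro x _ _
    simp only [relT, add_right_comm x 1 y, fA_add_one, fB_add_one, fC_add_one]
  · intro x hx hs
    replace hx := regularSet_of_sub_zero hx
    rw [sub_neg_eq_add] at hs
    simp only [relT, add_right_comm x τ y, fA_add_tau hx, fB_add_tau hx, fC_add_tau hx,
      fA_add_tau hs, fB_add_tau hs, fC_add_tau hs]
    ring
  · refine isBigO_pole hτ (g := fun u => fB (y, τ) - fB (u + y, τ))
      (r := fun u => fA (u + y, τ) * (fB (u, τ) - fB (y, τ)) + 1 / 2 * fC (u, τ)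
        - 1 / 2 * fC (u + y, τ) - fC (y, τ)) (fun u => ?_) ?_ (by simp) ?_
    · simp only [relT, zero_add]; ring
    · exact (differentiableAt_add_const (zero_add y) dB).const_sub _
    · exact ((((differentiableAt_add_const (zero_add y) dA).fun_mul (dB0.sub_const _)).fun_add
        (dC0.const_mul _)).fun_sub ((differentiableAt_add_const (zero_add y) dC).const_mul _)).sub_const _
  · refine isBigO_pole hτ (g := fun u => fB (-y + u, τ) - fB (y, τ))
      (r := fun u => fA (-y + u, τ) * (fB (y, τ) - fB (u, τ)) + 1 / 2 * fC (-y + u, τ)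
        - 1 / 2 * fC (u, τ) - fC (y, τ)) (fun u => ?_) ?_ ?_ ?_
    · have e : -y + u + y = u := by ring
      simp only [relT, e]; ring
    · exact (differentiableAt_const_add (add_zero _) dB').sub_const _
    · simp [fB_neg hτ]
    · exact ((((differentiableAt_const_add (add_zero _) dA').fun_mul (dB0.const_sub _)).fun_add
        ((differentiableAt_const_add (add_zero _) dC').const_mul _)).fun_sub
        (dC0.const_mul _)).sub_const _

/-- Replacing `y` by `y + τ` adds exactly `relV`, whence the hypothesis. There is no pole at `y =
0`, as `fA(y)` does not occur. -/
lemma exists_relT_const_right {x : ℂ} (hx : (x, τ) ∈ regularSet)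
    (hV : ∀ y, (y, τ) ∈ regularSet → (x + y, τ) ∈ regularSet → relV τ x y = 0) :
    ∃ c, ∀ y, (y, τ) ∈ regularSet → (x + y, τ) ∈ regularSet → relT τ x y = c := by
  have hτ : 0 < τ.im := hx.1
  have hnx := regularSet_neg hx
  have dA := differentiableAt_fA hx
  have dB := differentiableAt_fB hτ (.inr hx)
  have dC := differentiableAt_fC hτ (.inr hx)
  have dB' := differentiableAt_fB hτ (.inr hnx)
  have dC' := differentiableAt_fC hτ (.inr hnx)
  have dB0 := differentiableAt_fB hτ (.inl rfl)
  have dC0 := differentiableAt_fC hτ (.inl rfl)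
  suffices h : ∃ c, ∀ z, (z - 0, τ) ∈ regularSet → (z - -x, τ) ∈ regularSet →
      (fun y => relT τ x y) z = c by
    obtain ⟨c, hc⟩ := h
    exact ⟨c, fun y hy hs => hc y (by rwa [sub_zero]) (by rwa [sub_neg_eq_add, add_comm])⟩
  refine exists_const_of_elliptic hτ ?_ ?_ ?_ ?_ ?_
  · intro y hy hs
    replace hy := regularSet_of_sub_zero hy
    rw [sub_neg_eq_add, add_comm] at hs
    exact differentiableAt_relT_shape (differentiableAt_const _) (differentiableAt_fB hτ (.inr hy))
      (differentiableAt_const_add rfl (differentiableAt_fB hτ (.inr hs)))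
      (differentiableAt_const_add rfl (differentiableAt_fA hs)) (differentiableAt_const _)
      (differentiableAt_const _)
      (differentiableAt_const_add rfl (differentiableAt_fC hτ (.inr hs)))
      (differentiableAt_fC hτ (.inr hy))
  · intro y _ _
    simp only [relT, ← add_assoc, fA_add_one, fB_add_one, fC_add_one]
  · intro y hy hs
    replace hy := regularSet_of_sub_zero hy
    rw [sub_neg_eq_add, add_comm] at hs
    have hV := hV y hy hs
    simp only [relV] at hV
    simp only [relT, ← add_assoc, fB_add_tau hy, fC_add_tau hy,
      fA_add_tau hs, fB_add_tau hs, fC_add_tau hs]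
    linear_combination hV
  · refine isBigO_one_of_continuousAt (DifferentiableAt.continuousAt (𝕜 := ℂ) ?_)
    simp only [zero_add]
    exact differentiableAt_relT_shape (differentiableAt_const _) dB0
      (differentiableAt_const_add (add_zero _) dB) (differentiableAt_const_add (add_zero _) dA)
      (differentiableAt_const _) (differentiableAt_const _)
      (differentiableAt_const_add (add_zero _) dC) dC0
  · refine isBigO_pole hτ (g := fun u => fB (x, τ) - fB (-x + u, τ))
      (r := fun u => fA (x, τ) * (fB (-x + u, τ) - fB (u, τ)) + 1 / 2 * fC (x, τ)
        - 1 / 2 * fC (u, τ) - fC (-x + u, τ)) (fun u => ?_) ?_ ?_ ?_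
    · have e : x + (-x + u) = u := by ring
      simp only [relT, e]; ring
    · exact (differentiableAt_const_add (add_zero _) dB').const_sub _
    · simp [fB_neg hτ]
    · exact ((((differentiableAt_const_add (add_zero _) dB').fun_sub dB0).const_mul _).add_const
        _ |>.fun_sub (dC0.const_mul _)).fun_sub (differentiableAt_const_add (add_zero _) dC')

/-- As for `relT`, with `fC` in the cofactors; at `x = -y` the factor `fC(x) + fC(y)` vanishes
because `fC` is odd. -/
lemma exists_relU_const_left {y : ℂ} (hy : (y, τ) ∈ regularSet) :
    ∃ c, ∀ x, (x, τ) ∈ regularSet → (x + y, τ) ∈ regularSet → relU τ x y = c := by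
  have hτ : 0 < τ.im := hy.1
  have hny := regularSet_neg hy
  have dA := differentiableAt_fA hy
  have dB := differentiableAt_fB hτ (.inr hy)
  have dC := differentiableAt_fC hτ (.inr hy)
  have dE := differentiableAt_fE hτ (.inr hy)
  have dA' := differentiableAt_fA hny
  have dB' := differentiableAt_fB hτ (.inr hny)
  have dC' := differentiableAt_fC hτ (.inr hny)
  have dE' := differentiableAt_fE hτ (.inr hny)
  have dB0 := differentiableAt_fB hτ (.inl rfl)
  have dC0 := differentiableAt_fC hτ (.inl rfl)
  have dE0 := differentiableAt_fE hτ (.inl rfl)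
  suffices h : ∃ c, ∀ z, (z - 0, τ) ∈ regularSet → (z - -y, τ) ∈ regularSet →
      (fun x => relU τ x y) z = c by
    obtain ⟨c, hc⟩ := h
    exact ⟨c, fun x hx hs => hc x (by rwa [sub_zero]) (by rwa [sub_neg_eq_add])⟩
  refine exists_const_of_elliptic hτ ?_ ?_ ?_ ?_ ?_
  · intro x hx hs
    replace hx := regularSet_of_sub_zero hx
    rw [sub_neg_eq_add] at hs
    exact differentiableAt_relU_shape (differentiableAt_fA hx) (differentiableAt_const _)
      (differentiableAt_add_const rfl (differentiableAt_fC hτ (.inr hs)))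
      (differentiableAt_add_const rfl (differentiableAt_fA hs)) (differentiableAt_fC hτ (.inr hx))
      (differentiableAt_fB hτ (.inr hx))
      (differentiableAt_add_const rfl (differentiableAt_fB hτ (.inr hs)))
      (differentiableAt_fE hτ (.inr hx))
      (differentiableAt_add_const rfl (differentiableAt_fE hτ (.inr hs))) (differentiableAt_const _)
  · intro x _ _
    simp only [relU, add_right_comm x 1 y, fA_add_one, fB_add_one, fC_add_one, fE_add_one]
  · intro x hx hs
    replace hx := regularSet_of_sub_zero hx
    rw [sub_neg_eq_add] at hs
    simp only [relU, add_right_comm x τ y, fA_add_tau hx, fB_add_tau hx, fC_add_tau hx,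
      fE_add_tau hx, fA_add_tau hs, fB_add_tau hs, fC_add_tau hs, fE_add_tau hs]
    ring
  · refine isBigO_pole hτ (g := fun u => fC (y, τ) - fC (u + y, τ))
      (r := fun u => - (fA (u + y, τ) * (fC (u, τ) + fC (y, τ))) + 2 * (fB (u, τ) * fB (u + y, τ))
        - 1 / 3 * (fE (u, τ) + fE (u + y, τ) + 3 * fE (y, τ))) (fun u => ?_) ?_ (by simp) ?_
    · simp only [relU, zero_add]; ring
    · exact (differentiableAt_add_const (zero_add y) dC).const_sub _
    · exact (((differentiableAt_add_const (zero_add y) dA).fun_mul (dC0.add_const _)).fun_neg.fun_add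
        ((dB0.fun_mul (differentiableAt_add_const (zero_add y) dB)).const_mul _)).fun_sub
        (((dE0.fun_add (differentiableAt_add_const (zero_add y) dE)).add_const _).const_mul _)
  · refine isBigO_pole hτ (g := fun u => - (fC (-y + u, τ) + fC (y, τ)))
      (r := fun u => fA (-y + u, τ) * (fC (y, τ) - fC (u, τ)) + 2 * (fB (-y + u, τ) * fB (u, τ))
        - 1 / 3 * (fE (-y + u, τ) + fE (u, τ) + 3 * fE (y, τ))) (fun u => ?_) ?_ ?_ ?_
    · have e : -y + u + y = u := by ring
      simp only [relU, e]; ring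
    · exact ((differentiableAt_const_add (add_zero _) dC').add_const _).fun_neg
    · simp [fC_neg hτ]
    · exact (((differentiableAt_const_add (add_zero _) dA').fun_mul (dC0.const_sub _)).fun_add
        (((differentiableAt_const_add (add_zero _) dB').fun_mul dB0).const_mul _)).fun_sub
        ((((differentiableAt_const_add (add_zero _) dE').fun_add dE0).add_const _).const_mul _)

/-- Replacing `y` by `y + τ` adds `-2 relT - relV`. -/
lemma exists_relU_const_right {x : ℂ} (hx : (x, τ) ∈ regularSet)
    (hV : ∀ y, (y, τ) ∈ regularSet → (x + y, τ) ∈ regularSet → relV τ x y = 0)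
    (hT : ∀ y, (y, τ) ∈ regularSet → (x + y, τ) ∈ regularSet → relT τ x y = 0) :
    ∃ c, ∀ y, (y, τ) ∈ regularSet → (x + y, τ) ∈ regularSet → relU τ x y = c := by
  have hτ : 0 < τ.im := hx.1
  have hnx := regularSet_neg hx
  have dA := differentiableAt_fA hx
  have dB := differentiableAt_fB hτ (.inr hx)
  have dC := differentiableAt_fC hτ (.inr hx)
  have dE := differentiableAt_fE hτ (.inr hx)
  have dC' := differentiableAt_fC hτ (.inr hnx)
  have dE' := differentiableAt_fE hτ (.inr hnx)
  have dB0 := differentiableAt_fB hτ (.inl rfl)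
  have dC0 := differentiableAt_fC hτ (.inl rfl)
  have dE0 := differentiableAt_fE hτ (.inl rfl)
  suffices h : ∃ c, ∀ z, (z - 0, τ) ∈ regularSet → (z - -x, τ) ∈ regularSet →
      (fun y => relU τ x y) z = c by
    obtain ⟨c, hc⟩ := h
    exact ⟨c, fun y hy hs => hc y (by rwa [sub_zero]) (by rwa [sub_neg_eq_add, add_comm])⟩
  refine exists_const_of_elliptic hτ ?_ ?_ ?_ ?_ ?_
  · intro y hy hs
    replace hy := regularSet_of_sub_zero hy
    rw [sub_neg_eq_add, add_comm] at hs
    exact differentiableAt_relU_shape (differentiableAt_const _) (differentiableAt_fC hτ (.inr hy))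
      (differentiableAt_const_add rfl (differentiableAt_fC hτ (.inr hs)))
      (differentiableAt_const_add rfl (differentiableAt_fA hs)) (differentiableAt_const _)
      (differentiableAt_const _)
      (differentiableAt_const_add rfl (differentiableAt_fB hτ (.inr hs)))
      (differentiableAt_const _)
      (differentiableAt_const_add rfl (differentiableAt_fE hτ (.inr hs)))
      (differentiableAt_fE hτ (.inr hy))
  · intro y _ _
    simp only [relU, ← add_assoc, fA_add_one, fB_add_one, fC_add_one, fE_add_one]
  · intro y hy hs
    replace hy := regularSet_of_sub_zero hy
    rw [sub_neg_eq_add, add_comm] at hs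
    have hV := hV y hy hs
    have hT := hT y hy hs
    simp only [relV] at hV
    simp only [relT] at hT
    simp only [relU, ← add_assoc, fC_add_tau hy, fE_add_tau hy,
      fA_add_tau hs, fB_add_tau hs, fC_add_tau hs, fE_add_tau hs]
    linear_combination -2 * hT - hV
  · refine isBigO_one_of_continuousAt (DifferentiableAt.continuousAt (𝕜 := ℂ) ?_)
    simp only [zero_add]
    exact differentiableAt_relU_shape (differentiableAt_const _) dC0
      (differentiableAt_const_add (add_zero _) dC) (differentiableAt_const_add (add_zero _) dA)
      (differentiableAt_const _) (differentiableAt_const _)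
      (differentiableAt_const_add (add_zero _) dB) (differentiableAt_const _)
      (differentiableAt_const_add (add_zero _) dE) dE0
  · refine isBigO_pole hτ (g := fun u => - (fC (x, τ) + fC (-x + u, τ)))
      (r := fun u => fA (x, τ) * (fC (-x + u, τ) - fC (u, τ)) + 2 * (fB (x, τ) * fB (u, τ))
        - 1 / 3 * (fE (x, τ) + fE (u, τ) + 3 * fE (-x + u, τ))) (fun u => ?_) ?_ ?_ ?_
    · have e : x + (-x + u) = u := by ring
      simp only [relU, e]; ring
    · exact ((differentiableAt_const_add (add_zero _) dC').const_add _).fun_neg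
    · simp [fC_neg hτ]
    · exact ((((differentiableAt_const_add (add_zero _) dC').fun_sub dC0).const_mul _).fun_add
        ((dB0.const_mul _).const_mul _)).fun_sub
        (((dE0.const_add _).fun_add ((differentiableAt_const_add (add_zero _) dE').const_mul
          _)).const_mul _)

/-- A function of two variables that is separately constant on generic points is constant. -/
lemma exists_const_of_separately {R : ℂ → ℂ → ℂ} (hτ : 0 < τ.im)
    (hl : ∀ y, (y, τ) ∈ regularSet → ∃ c, ∀ x, (x, τ) ∈ regularSet → (x + y, τ) ∈ regularSet →
      R x y = c)
    (hr : ∀ x, (x, τ) ∈ regularSet → ∃ c, ∀ y, (y, τ) ∈ regularSet → (x + y, τ) ∈ regularSet →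
      R x y = c) :
    ∃ c, ∀ x y, (x, τ) ∈ regularSet → (y, τ) ∈ regularSet → (x + y, τ) ∈ regularSet →
      R x y = c := by
  have key : ∀ x y x' y', (x, τ) ∈ regularSet → (y, τ) ∈ regularSet → (x + y, τ) ∈ regularSet →
      (x', τ) ∈ regularSet → (y', τ) ∈ regularSet → (x' + y', τ) ∈ regularSet →
      R x y = R x' y' := by
    intro x y x' y' hx hy hs hx' hy' hs'
    have htr : ∀ w : ℂ, Tendsto (fun u => u + w) (𝓝[≠] 0) (𝓝[≠] (0 + w)) := fun w => by
      refine tendsto_nhdsWithin_iff.2 ⟨(Continuous.tendsto (by fun_prop) 0).mono_left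
        nhdsWithin_le_nhds, ?_⟩
      filter_upwards [self_mem_nhdsWithin] with u hu
      simpa using hu
    -- A generic small `v` links the two pairs through `(x, y)`, `(v, y)`, `(v, y')`, `(x', y')`,
    -- changing one variable at a time.
    obtain ⟨v, ⟨hv, hvy⟩, hvy'⟩ := (((eventually_regularSet hτ 0).and
      ((htr y).eventually (eventually_regularSet hτ _))).and
      ((htr y').eventually (eventually_regularSet hτ _))).exists
    obtain ⟨c, hc⟩ := hl y hy
    obtain ⟨c', hc'⟩ := hr v hv
    obtain ⟨c'', hc''⟩ := hl y' hy'
    rw [hc x hx hs, ← hc v hv hvy, hc' y hy hvy, ← hc' y' hy' hvy', hc'' v hv hvy',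
      hc'' x' hx' hs']
  by_cases h : ∃ x y, (x, τ) ∈ regularSet ∧ (y, τ) ∈ regularSet ∧ (x + y, τ) ∈ regularSet
  · obtain ⟨x', y', hx', hy', hs'⟩ := h
    exact ⟨R x' y', fun x y hx hy hs => key x y x' y' hx hy hs hx' hy' hs'⟩
  · exact ⟨0, fun x y hx hy hs => absurd ⟨x, y, hx, hy, hs⟩ h⟩

end Identities

/-! ### Mean values and the vanishing of the constants. -/

section Averages

/-- `g` is continuous with mean value `b` over every unit interval. -/
def HasMean (g : ℝ → ℂ) (b : ℂ) : Prop :=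
  Continuous g ∧ ∀ s : ℝ, ∫ t in (0 : ℝ)..1, g (s + t) = b

/-- `F` is continuous with mean value `k` over the unit square. -/
def HasMean₂ (F : ℝ → ℝ → ℂ) (k : ℂ) : Prop :=
  Continuous (fun p : ℝ × ℝ => F p.1 p.2) ∧
    ∫ s in (0 : ℝ)..1, ∫ t in (0 : ℝ)..1, F s t = k

variable {F G : ℝ → ℝ → ℂ} {f g : ℝ → ℂ} {a b k l : ℂ}

lemma HasMean.const (b : ℂ) : HasMean (fun _ => b) b := ⟨continuous_const, fun s => by simp⟩

lemma HasMean.integral (h : HasMean g b) : ∫ t in (0 : ℝ)..1, g t = b := by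
  simpa using h.2 0

lemma HasMean₂.continuous_right (h : Continuous (fun p : ℝ × ℝ => F p.1 p.2)) (s : ℝ) :
    Continuous (F s) :=
  h.comp (continuous_const.prodMk continuous_id)

lemma HasMean₂.continuous_inner (h : Continuous (fun p : ℝ × ℝ => F p.1 p.2)) :
    Continuous fun s => ∫ t in (0 : ℝ)..1, F s t :=
  intervalIntegral.continuous_parametric_intervalIntegral_of_continuous' (f := F) h 0 1

lemma HasMean₂.add (h : HasMean₂ F k) (h' : HasMean₂ G l) :
    HasMean₂ (fun s t => F s t + G s t) (k + l) := by
  refine ⟨h.1.add h'.1, ?_⟩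
  rw [← h.2, ← h'.2, ← intervalIntegral.integral_add
    ((continuous_inner h.1).intervalIntegrable _ _) ((continuous_inner h'.1).intervalIntegrable _ _)]
  congr 1
  funext s
  exact intervalIntegral.integral_add ((continuous_right h.1 s).intervalIntegrable _ _)
    ((continuous_right h'.1 s).intervalIntegrable _ _)

lemma HasMean₂.const_mul (c : ℂ) (h : HasMean₂ F k) :
    HasMean₂ (fun s t => c * F s t) (c * k) := by
  refine ⟨continuous_const.mul h.1, ?_⟩
  simp only [intervalIntegral.integral_const_mul, h.2]

lemma HasMean₂.sub (h : HasMean₂ F k) (h' : HasMean₂ G l) :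
    HasMean₂ (fun s t => F s t - G s t) (k - l) := by
  have := h.add (h'.const_mul (-1))
  simpa only [neg_one_mul, ← sub_eq_add_neg] using this

lemma HasMean₂.swap (h : HasMean₂ F k) : HasMean₂ (fun s t => F t s) k := by
  refine ⟨h.1.comp continuous_swap, ?_⟩
  rw [← h.2]
  refine (MeasureTheory.intervalIntegral_intervalIntegral_swap ?_).symm
  refine (h.1.continuousOn.integrableOn_compact
    ((isCompact_uIcc (a := (0 : ℝ)) (b := 1)).prod (isCompact_uIcc (a := (0 : ℝ)) (b := 1)))).mono_set ?_
  exact prod_mono uIoc_subset_uIcc uIoc_subset_uIcc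

lemma HasMean.mul₂ (hf : HasMean f a) (hG : Continuous fun p : ℝ × ℝ => G p.1 p.2)
    (h : ∀ s, ∫ t in (0 : ℝ)..1, G s t = b) : HasMean₂ (fun s t => f s * G s t) (a * b) := by
  refine ⟨(hf.1.comp continuous_fst).mul hG, ?_⟩
  simp only [intervalIntegral.integral_const_mul, h, intervalIntegral.integral_mul_const,
    hf.integral]

lemma HasMean.mul_fst_snd (hf : HasMean f a) (hg : HasMean g b) :
    HasMean₂ (fun s t => f s * g t) (a * b) :=
  hf.mul₂ (hg.1.comp continuous_snd) fun _ => hg.integral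

/-- For fixed `s` the inner integral is a mean of `g` over a shifted unit interval, which is why
`HasMean` asks for all of them. -/
lemma HasMean.mul_fst_add (hf : HasMean f a) (hg : HasMean g b) :
    HasMean₂ (fun s t => f s * g (s + t)) (a * b) :=
  hf.mul₂ (hg.1.comp (continuous_fst.add continuous_snd)) hg.2

lemma HasMean.mul_snd_add (hf : HasMean f a) (hg : HasMean g b) :
    HasMean₂ (fun s t => f t * g (s + t)) (a * b) := by
  have := (hf.mul_fst_add hg).swap
  simpa only [add_comm] using this

lemma HasMean.fst (hf : HasMean f a) : HasMean₂ (fun s _ => f s) a := by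
  simpa using hf.mul_fst_snd (HasMean.const 1)

lemma HasMean.snd (hf : HasMean f a) : HasMean₂ (fun _ t => f t) a := hf.fst.swap

lemma HasMean.add (hf : HasMean f a) : HasMean₂ (fun s t => f (s + t)) a := by
  simpa using (HasMean.const 1).mul_fst_add hf

lemma HasMean₂.eq_of_const {c : ℂ} (h : HasMean₂ F k) (hc : ∀ s t, F s t = c) : c = k := by
  simpa [hc] using h.2

variable {τ : ℂ}

lemma mem_regularSet_of_strip {z : ℂ} (h0 : 0 < z.im) (h1 : z.im < τ.im) :
    (z, τ) ∈ regularSet := by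
  have hτ := h0.trans h1
  refine ⟨hτ, fun m n h => ?_⟩
  have him : z.im = n * τ.im := by simpa using congrArg im h
  rw [him] at h0 h1
  have h2 : 0 < (n : ℝ) := by
    by_contra! h
    nlinarith
  have h3 : (n : ℝ) < 1 := by
    by_contra! h
    nlinarith
  have h4 : 0 < n := by exact_mod_cast h2
  have h5 : n < 1 := by exact_mod_cast h3
  omega

/-- `F - c` has a 1-periodic primitive, so its integral over a period is zero. -/
lemma integral_eq_of_primitive {F P : ℂ → ℂ} {z c : ℂ}
    (hP : ∀ t : ℝ, HasDerivAt P (F (z + t) - c) (z + t)) (hper : P (z + 1) = P z)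
    (hF : Continuous fun t : ℝ => F (z + t)) : ∫ t in (0 : ℝ)..1, F (z + t) = c := by
  have hd : ∀ t : ℝ, HasDerivAt (fun t : ℝ => P (z + t)) (F (z + t) - c) t := fun t => by
    have h := (hP t).comp_const_add z (t : ℂ)
    exact h.comp_ofReal
  have hi : IntervalIntegrable (fun t : ℝ => F (z + t) - c) MeasureTheory.volume 0 1 :=
    (hF.sub continuous_const).intervalIntegrable 0 1
  have := intervalIntegral.integral_eq_sub_of_hasDerivAt (fun t _ => hd t) hi
  rw [intervalIntegral.integral_sub (hF.intervalIntegrable _ _)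
    (continuous_const.intervalIntegrable _ _)] at this
  simpa [hper, sub_eq_zero] using this

lemma W_psi_add_one (r J m : ℕ) (z : ℂ) : W (psi r) J m (z + 1, τ) = W (psi r) J m (z, τ) := by
  refine tsum_congr fun k => ?_
  have e : z + 1 + ((k + J : ℕ) : ℂ) * τ = z + ((k + J : ℕ) : ℂ) * τ + (1 : ℤ) := by
    push_cast; ring
  simp only [e, psi, ex_add, ex_int, mul_one]

lemma hasDerivAt_W_psi_one {J m : ℕ} {z : ℂ} (hτ : 0 < τ.im) (h : 0 < (z + J * τ).im) :
    HasDerivAt (fun w => W (psi 1) J m (w, τ)) (W L0 J m (z, τ)) z :=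
  hasDerivAt_fst_of_lin (q := (z, τ)) (hasFDerivAt_W
    (fun _ hu => (hasDerivAt_psi 0 hu).congr_deriv (psi_zero hu))
    (expDecay_psi _) expDecay_L0 J m hτ h)

lemma hasDerivAt_W_psi_one_neg {m : ℕ} {z : ℂ} (hτ : 0 < τ.im) (h : z.im < τ.im) :
    HasDerivAt (fun w => W (psi 1) 1 m (-w, τ)) (-W L0 1 m (-z, τ)) z := by
  have h1 := hasDerivAt_W_psi_one (J := 1) (m := m) (z := -z) hτ (by simpa using h)
  simpa using! h1.scomp z (hasDerivAt_neg z)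

lemma hasMean_of_primitive {F P : ℂ → ℂ} {z c : ℂ} (h0 : 0 < z.im) (h1 : z.im < τ.im)
    (hP : ∀ w : ℂ, 0 < w.im → w.im < τ.im → HasDerivAt P (F w - c) w)
    (hper : ∀ w, P (w + 1) = P w)
    (hF : ∀ w : ℂ, (w, τ) ∈ regularSet → DifferentiableAt ℂ F w) :
    HasMean (fun t => F (z + t)) c := by
  have hc : Continuous fun t : ℝ => F (z + t) := by
    refine continuous_iff_continuousAt.2 fun t => ?_
    have hd := (hF (z + t) (mem_regularSet_of_strip (by simpa using h0)
      (by simpa using h1))).continuousAt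
    exact ContinuousAt.comp (f := fun t : ℝ => z + (t : ℂ)) hd (by fun_prop)
  refine ⟨hc, fun s => ?_⟩
  have hcs := hc.comp (continuous_const.add continuous_id : Continuous fun t : ℝ => s + t)
  have := integral_eq_of_primitive (F := F) (P := P) (z := z + s) (c := c)
    (fun t => hP _ (by simpa using h0) (by simpa using h1)) (hper _)
    (by simpa [add_assoc, Function.comp_def] using hcs)
  simpa [add_assoc] using this

variable {z : ℂ}

lemma W_psi_neg_add_one (r J m : ℕ) (z : ℂ) :
    W (psi r) J m (-(z + 1), τ) = W (psi r) J m (-z, τ) := by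
  rw [← W_psi_add_one]
  congr 2
  ring

/-- The mean is the constant in the definition: in the strip the `Li_0` sums have the convergent,
1-periodic `Li_1` sums as primitives. The same holds for `fB`, `fC`, `fE`. -/
lemma hasMean_fA (h0 : 0 < z.im) (h1 : z.im < τ.im) :
    HasMean (fun t => fA (z + t, τ)) (1 / 2) := by
  have hτ := h0.trans h1
  refine hasMean_of_primitive (F := fun w => fA (w, τ))
    (P := fun w => W (psi 1) 0 0 (w, τ) + W (psi 1) 1 0 (-w, τ)) h0 h1 (fun w hw0 hw1 => ?_)
    (fun w => by simp only [W_psi_add_one, W_psi_neg_add_one]) fun w hw => differentiableAt_fA hw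
  refine ((hasDerivAt_W_psi_one hτ (by simpa using hw0)).fun_add
    (hasDerivAt_W_psi_one_neg hτ hw1)).congr_deriv ?_
  rw [fA]; ring

lemma hasMean_fB (h0 : 0 < z.im) (h1 : z.im < τ.im) :
    HasMean (fun t => fB (z + t, τ)) (-1 / 12) := by
  have hτ := h0.trans h1
  refine hasMean_of_primitive (F := fun w => fB (w, τ))
    (P := fun w => W (psi 1) 0 1 (w, τ) - W (psi 1) 1 1 (-w, τ)) h0 h1 (fun w hw0 hw1 => ?_)
    (fun w => by simp only [W_psi_add_one, W_psi_neg_add_one])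
    fun w hw => differentiableAt_fB hτ (.inr hw)
  refine ((hasDerivAt_W_psi_one hτ (by simpa using hw0)).fun_sub
    (hasDerivAt_W_psi_one_neg hτ hw1)).congr_deriv ?_
  rw [fB]; ring

lemma hasMean_fC (h0 : 0 < z.im) (h1 : z.im < τ.im) :
    HasMean (fun t => fC (z + t, τ)) 0 := by
  have hτ := h0.trans h1
  refine hasMean_of_primitive (F := fun w => fC (w, τ))
    (P := fun w => W (psi 1) 0 2 (w, τ) + W (psi 1) 1 2 (-w, τ)) h0 h1 (fun w hw0 hw1 => ?_)
    (fun w => by simp only [W_psi_add_one, W_psi_neg_add_one])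
    fun w hw => differentiableAt_fC hτ (.inr hw)
  refine ((hasDerivAt_W_psi_one hτ (by simpa using hw0)).fun_add
    (hasDerivAt_W_psi_one_neg hτ hw1)).congr_deriv ?_
  rw [fC]; ring

lemma hasMean_fE (h0 : 0 < z.im) (h1 : z.im < τ.im) :
    HasMean (fun t => fE (z + t, τ)) (1 / 120) := by
  have hτ := h0.trans h1
  refine hasMean_of_primitive (F := fun w => fE (w, τ))
    (P := fun w => W (psi 1) 0 3 (w, τ) - W (psi 1) 1 3 (-w, τ)) h0 h1 (fun w hw0 hw1 => ?_)
    (fun w => by simp only [W_psi_add_one, W_psi_neg_add_one])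
    fun w hw => differentiableAt_fE hτ (.inr hw)
  refine ((hasDerivAt_W_psi_one hτ (by simpa using hw0)).fun_sub
    (hasDerivAt_W_psi_one_neg hτ hw1)).congr_deriv ?_
  rw [fE]; ring

/-- A separately constant relation vanishes if its mean over a horizontal unit square does. -/
lemma eq_zero_of_mean {R : ℂ → ℂ → ℂ} (hτ : 0 < τ.im)
    (hl : ∀ y, (y, τ) ∈ regularSet → ∃ c, ∀ x, (x, τ) ∈ regularSet → (x + y, τ) ∈ regularSet →
      R x y = c)
    (hr : ∀ x, (x, τ) ∈ regularSet → ∃ c, ∀ y, (y, τ) ∈ regularSet → (x + y, τ) ∈ regularSet →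
      R x y = c)
    (hm : HasMean₂ (fun s t => R (τ / 4 + s) (τ / 4 + t)) 0) {x y : ℂ}
    (hx : (x, τ) ∈ regularSet) (hy : (y, τ) ∈ regularSet) (hs : (x + y, τ) ∈ regularSet) :
    R x y = 0 := by
  obtain ⟨c, hc⟩ := exists_const_of_separately hτ hl hr
  have h4 : (τ / 4).im = τ.im / 4 := by simp
  have him : ∀ s : ℝ, (τ / 4 + (s : ℂ), τ) ∈ regularSet := fun s =>
    mem_regularSet_of_strip (by simp [h4, hτ]) (by simp [h4]; linarith)
  rw [hc x y hx hy hs]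
  refine hm.eq_of_const fun s t => hc _ _ (him s) (him t) ?_
  refine mem_regularSet_of_strip ?_ ?_
  · simp [h4, hτ]
  · simp [h4]; linarith

lemma quarter_add (τ : ℂ) (s t : ℝ) :
    τ / 4 + (s : ℂ) + (τ / 4 + t) = τ / 2 + ((s + t : ℝ) : ℂ) := by
  push_cast; ring

lemma im_quarter (hτ : 0 < τ.im) :
    0 < (τ / 4).im ∧ (τ / 4).im < τ.im ∧ 0 < (τ / 2).im ∧ (τ / 2).im < τ.im := by
  have h4 : (τ / 4).im = τ.im / 4 := by simp
  have h2 : (τ / 2).im = τ.im / 2 := by simp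
  rw [h4, h2]
  refine ⟨?_, ?_, ?_, ?_⟩ <;> linarith

theorem relV_eq_zero {x y : ℂ} (hx : (x, τ) ∈ regularSet) (hy : (y, τ) ∈ regularSet)
    (hs : (x + y, τ) ∈ regularSet) : relV τ x y = 0 := by
  obtain ⟨h0, h1, k0, k1⟩ := im_quarter hx.1
  refine eq_zero_of_mean hx.1 (fun _ => exists_relV_const_left) (fun _ => exists_relV_const_right)
    ?_ hx hy hs
  have mA := hasMean_fA h0 h1
  have mB := hasMean_fB h0 h1
  have mA' := hasMean_fA k0 k1
  have mB' := hasMean_fB k0 k1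
  -- The means add up to `1/4 + 1/4 - 1/4 - 3/12 = 0`.
  convert (((((mA.mul_fst_add mA').add (mA.mul_snd_add mA')).sub (mA.mul_fst_snd mA)).add
    mB.fst).add mB'.add).add mB.snd using 1
  · funext s t
    rw [relV, quarter_add]
    ring
  · norm_num

theorem relT_eq_zero {x y : ℂ} (hx : (x, τ) ∈ regularSet) (hy : (y, τ) ∈ regularSet)
    (hs : (x + y, τ) ∈ regularSet) : relT τ x y = 0 := by
  obtain ⟨h0, h1, k0, k1⟩ := im_quarter hx.1
  refine eq_zero_of_mean hx.1 (fun _ => exists_relT_const_left)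
    (fun _ hx => exists_relT_const_right hx fun _ => relV_eq_zero hx) ?_ hx hy hs
  have mA := hasMean_fA h0 h1
  have mB := hasMean_fB h0 h1
  have mC := hasMean_fC h0 h1
  have mA' := hasMean_fA k0 k1
  have mB' := hasMean_fB k0 k1
  have mC' := hasMean_fC k0 k1
  convert ((((((mA.mul_fst_snd mB).sub (mA.mul_fst_add mB')).add (mB.mul_fst_add mA')).sub
    (mB.mul_snd_add mA')).add (mC.fst.const_mul (1 / 2))).sub (mC'.add.const_mul (1 / 2))).sub
    mC.snd using 1
  · funext s t
    rw [relT, quarter_add]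
    ring
  · norm_num

theorem relU_eq_zero {x y : ℂ} (hx : (x, τ) ∈ regularSet) (hy : (y, τ) ∈ regularSet)
    (hs : (x + y, τ) ∈ regularSet) : relU τ x y = 0 := by
  obtain ⟨h0, h1, k0, k1⟩ := im_quarter hx.1
  refine eq_zero_of_mean hx.1 (fun _ => exists_relU_const_left)
    (fun _ hx => exists_relU_const_right hx (fun _ => relV_eq_zero hx) fun _ => relT_eq_zero hx)
    ?_ hx hy hs
  have mA := hasMean_fA h0 h1
  have mB := hasMean_fB h0 h1
  have mC := hasMean_fC h0 h1
  have mE := hasMean_fE h0 h1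
  have mA' := hasMean_fA k0 k1
  have mB' := hasMean_fB k0 k1
  have mC' := hasMean_fC k0 k1
  have mE' := hasMean_fE k0 k1
  -- The products with `fC` average to `0`; what is left is `2/144 - (1/3)(5/120) = 0`.
  convert (((((((mA.mul_fst_snd mC).sub (mA.mul_fst_add mC')).sub (mC.mul_fst_add mA')).sub
    (mC.mul_snd_add mA')).add ((mB.mul_fst_add mB').const_mul 2)).sub
    (mE.fst.const_mul (1 / 3))).sub (mE'.add.const_mul (1 / 3))).sub mE.snd using 1
  · funext s t
    rw [relU, quarter_add]
    ring
  · norm_num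

end Averages

/-! ### The Eisenstein series and the `B_2` identities. -/

/-- Lambert series: `∑ σ_3(n) q^n = ∑ n^3 q^n / (1 - q^n)`, and `L0(nτ) = q^n / (1 - q^n)`. -/
lemma E₄_eq (τ : ℍ) : ModularForm.E₄ τ = 1 + 240 * W L0 1 3 (0, (τ : ℂ)) := by
  have hB : bernoulli 4 = -1 / 30 := by
    rw [bernoulli_eq_bernoulli'_of_ne_one (by norm_num), bernoulli'_four]
  have hq : ‖ex τ‖ < 1 := norm_ex_lt_one τ.im_pos
  have h1 := EisensteinSeries.q_expansion_bernoulli (k := 4) (by norm_num) (by decide) τ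
  have h2 := tsum_pow_div_one_sub_eq_tsum_sigma hq 3
  have h3 : W L0 1 3 (0, (τ : ℂ)) =
      ∑' n : ℕ+, (n : ℂ) ^ 3 * ex τ ^ (n : ℕ) / (1 - ex τ ^ (n : ℕ)) := by
    rw [tsum_pnat_eq_tsum_succ (f := fun n => (n : ℂ) ^ 3 * ex τ ^ n / (1 - ex τ ^ n))]
    refine tsum_congr fun k => ?_
    rw [L0, zero_add, ex_nat_mul, mul_div_assoc]
  rw [h3, h2]
  refine h1.trans ?_
  simp only [hB, zpow_natCast, ex]
  push_cast
  norm_num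

lemma fD_eq (z : ℂ) (τ : ℍ) : fD (z, (τ : ℂ)) = fE (z, (τ : ℂ)) - ModularForm.E₄ τ / 120 := by
  rw [E₄_eq, fD, fE]
  ring

end EllipticTrilog

end

theorem mainTheorem5 :
    (∀ p ∈ EllipticTrilog.regularSet, ∃ g : ℂ × ℂ → ℂ, EllipticTrilog.IsBranchAt g p) ∧
    ∀ (τ : ℍ) (x y : ℂ),
      (x, (τ : ℂ)) ∈ EllipticTrilog.regularSet →
      (y, (τ : ℂ)) ∈ EllipticTrilog.regularSet →
      (x + y, (τ : ℂ)) ∈ EllipticTrilog.regularSet →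
      (x + 2 * y, (τ : ℂ)) ∈ EllipticTrilog.regularSet →
      -- `fx`, `fy`, `fs`, `ft`: arbitrary branches of `f` near `x`, `y`, `x + y`, `x + 2 y`
      ∀ fx fy fs ft : ℂ × ℂ → ℂ,
        EllipticTrilog.IsBranchAt fx (x, (τ : ℂ)) →
        EllipticTrilog.IsBranchAt fy (y, (τ : ℂ)) →
        EllipticTrilog.IsBranchAt fs (x + y, (τ : ℂ)) →
        EllipticTrilog.IsBranchAt ft (x + 2 * y, (τ : ℂ)) →
        -- set (a), first identity
        (EllipticTrilog.pd 3 0 fx x τ *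
            (EllipticTrilog.pd 2 1 fy y τ - EllipticTrilog.pd 2 1 fs (x + y) τ)
          + EllipticTrilog.pd 3 0 fs (x + y) τ *
            (EllipticTrilog.pd 2 1 fx x τ - EllipticTrilog.pd 2 1 ft (x + 2 * y) τ)
          + EllipticTrilog.pd 3 0 ft (x + 2 * y) τ *
            (EllipticTrilog.pd 2 1 fs (x + y) τ - EllipticTrilog.pd 2 1 fy y τ)
          + (1 / 2 * EllipticTrilog.pd 1 2 fx x τ
            - 1 / 2 * EllipticTrilog.pd 1 2 ft (x + 2 * y) τ
            - 2 * EllipticTrilog.pd 1 2 fy y τ) = 0) ∧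
        -- set (a), second identity
        (EllipticTrilog.pd 3 0 fy y τ *
            (EllipticTrilog.pd 2 1 ft (x + 2 * y) τ - EllipticTrilog.pd 2 1 fx x τ)
          + EllipticTrilog.pd 3 0 fs (x + y) τ *
            (EllipticTrilog.pd 2 1 fx x τ - EllipticTrilog.pd 2 1 ft (x + 2 * y) τ)
          + 2 * EllipticTrilog.pd 3 0 ft (x + 2 * y) τ *
            (EllipticTrilog.pd 2 1 fs (x + y) τ - EllipticTrilog.pd 2 1 fy y τ)
          + (EllipticTrilog.pd 1 2 fx x τ
            + 2 * EllipticTrilog.pd 1 2 fs (x + y) τ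
            - 2 * EllipticTrilog.pd 1 2 fy y τ) = 0) ∧
        -- set (b), first identity
        ((EllipticTrilog.pd 3 0 fx x τ *
              (EllipticTrilog.pd 1 2 fs (x + y) τ - EllipticTrilog.pd 1 2 fy y τ)
            + EllipticTrilog.pd 3 0 fs (x + y) τ *
              (EllipticTrilog.pd 1 2 fx x τ + EllipticTrilog.pd 1 2 ft (x + 2 * y) τ)
            + EllipticTrilog.pd 3 0 ft (x + 2 * y) τ *
              (EllipticTrilog.pd 1 2 fs (x + y) τ + EllipticTrilog.pd 1 2 fy y τ))
          - 2 * (EllipticTrilog.pd 2 1 fs (x + y) τ * EllipticTrilog.pd 2 1 fx x τ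
            + EllipticTrilog.pd 2 1 fs (x + y) τ * EllipticTrilog.pd 2 1 ft (x + 2 * y) τ)
          + 1 / 3 * (EllipticTrilog.pd 0 3 fx x τ
            + 2 * EllipticTrilog.pd 0 3 fs (x + y) τ
            + EllipticTrilog.pd 0 3 ft (x + 2 * y) τ
            + 6 * EllipticTrilog.pd 0 3 fy y τ)
          + 1 / 36 * ModularForm.E₄ τ = 0) ∧
        -- set (b), second identity
        ((EllipticTrilog.pd 3 0 fy y τ *
              (EllipticTrilog.pd 1 2 ft (x + 2 * y) τ - EllipticTrilog.pd 1 2 fx x τ)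
            + 4 * EllipticTrilog.pd 3 0 ft (x + 2 * y) τ *
              (EllipticTrilog.pd 1 2 fy y τ + EllipticTrilog.pd 1 2 fs (x + y) τ)
            + EllipticTrilog.pd 3 0 fs (x + y) τ *
              (EllipticTrilog.pd 1 2 fx x τ + EllipticTrilog.pd 1 2 ft (x + 2 * y) τ))
          - 4 * (EllipticTrilog.pd 2 1 ft (x + 2 * y) τ * EllipticTrilog.pd 2 1 fs (x + y) τ
            + EllipticTrilog.pd 2 1 ft (x + 2 * y) τ * EllipticTrilog.pd 2 1 fy y τ)
          + 1 / 3 * (3 * EllipticTrilog.pd 0 3 fx x τ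
            + 8 * EllipticTrilog.pd 0 3 fs (x + y) τ
            + EllipticTrilog.pd 0 3 ft (x + 2 * y) τ
            + 8 * EllipticTrilog.pd 0 3 fy y τ)
          + 1 / 18 * ModularForm.E₄ τ = 0) := by
  refine ⟨fun p hp => EllipticTrilog.exists_isBranchAt hp, ?_⟩
  intro τ x y hx hy hs ht fx fy fs ft bx byy bs bt
  obtain ⟨x0, x1, x2, x3⟩ := bx.hasThirdJet.pd_eq
  obtain ⟨y0, y1, y2, y3⟩ := byy.hasThirdJet.pd_eq
  obtain ⟨s0, s1, s2, s3⟩ := bs.hasThirdJet.pd_eq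
  obtain ⟨t0, t1, t2, t3⟩ := bt.hasThirdJet.pd_eq
  rw [x0, x1, x2, x3, y0, y1, y2, y3, s0, s1, s2, s3, t0, t1, t2, t3]
  have e1 : x + y + y = x + 2 * y := by ring
  have e2 : y + (x + y) = x + 2 * y := by ring
  have e3 : x + y + -(x + 2 * y) = -y := by ring
  have hny := EllipticTrilog.regularSet_neg hy
  have hnt := EllipticTrilog.regularSet_neg ht
  have T1 := EllipticTrilog.relT_eq_zero hx hy hs
  have T2 := EllipticTrilog.relT_eq_zero hs hy (by rwa [e1])
  have T3 := EllipticTrilog.relT_eq_zero hy hx (by rwa [add_comm])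
  have T4 := EllipticTrilog.relT_eq_zero hy hs (by rwa [e2])
  have U1 := EllipticTrilog.relU_eq_zero hx hy hs
  have U2 := EllipticTrilog.relU_eq_zero hs hy (by rwa [e1])
  have U3 := EllipticTrilog.relU_eq_zero hy hx (by rwa [add_comm])
  have U4 := EllipticTrilog.relU_eq_zero hy hs (by rwa [e2])
  -- The points `x + y` and `-(x + 2y)` sum to `-y`. This relation supplies the product `fB(x + y)
  -- fB(y)` that cancels the one in `U3`, absent from the last identity.
  have U5 := EllipticTrilog.relU_eq_zero hs hnt (by rwa [e3])
  simp only [EllipticTrilog.relT, EllipticTrilog.relU, e1, e2, e3, add_comm y x,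
    EllipticTrilog.fA_neg hy, EllipticTrilog.fB_neg hx.1, EllipticTrilog.fC_neg hx.1,
    EllipticTrilog.fE_neg hx.1] at T1 T2 T3 T4 U1 U2 U3 U4 U5
  -- The `f^{(0,3)}` coefficients sum to `10/3` and `20/3`, so passing to `fE` releases `-E_4 / 36`
  -- and `-E_4 / 18`, which cancel the explicit `E_4` terms.
  simp only [EllipticTrilog.fD_eq]
  refine ⟨?_, ?_, ?_, ?_⟩
  · linear_combination T1 + T2
  · linear_combination -T3 + T2 - T4
  · linear_combination -U1 - U2
  · linear_combination -U3 - 2 * U2 - 2 * U4 + U5
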